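/- All graphs are finite, simple and undirected. A connected set of a graph $G=(V,E)$ is a nonempty set $S\subseteq V$ such that the subgraph of $G$ induced by $S$ is connected; $\mathrm{N}(G)$ denotes the number of connected sets of $G$. A graph $G$ is bicyclic if it is connected and $|E|=|V|+1$; $\mathbb{B}_n$ denotes the class of bicyclic graphs on $n$ vertices. For $n\ge 5$ let $L_n$ be the $n$-vertex graph obtained from two disjoint triangles and a path $P_{n-4}$ on $n-4$ vertices by identifying one end of the path with a vertex of one triangle and the other end with a vertex of the other triangle (for $n=5$ the two triangles share exactly one vertex). Let $A_5$ be the graph obtained from the complete graph on four vertices minus one edge by attaching one pendant vertex to a vertex of degree two. **Theorem.** Let $n>4$. Then $L_n\in\mathbb{B}_n$, $A_5\in\mathbb{B}_5$, and $$\mathrm{N}(L_n)=\frac{(n+6)(n-1)}{2}.$$ For every $G\in\mathbb{B}_n$, $$\mathrm{N}(G)\ \ge\ \mathrm{N}(L_n).$$ If $n>5$, equality holds if and only if $G$ is isomorphic to $L_n$. If $n=5$, equality holds if and only if $G$ is isomorphic to $L_5$ or to $A_5$. -/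

import Mathlib

namespace SimpleGraph

/-- The number of connected sets of `G`: nonempty vertex subsets inducing a connected subgraph. -/
noncomputable def numConnectedSets {V : Type*} (G : SimpleGraph V) : ℕ :=
  {S : Set V | S.Nonempty ∧ (G.induce S).Connected}.ncard

/-- A finite graph is bicyclic if it is connected and has exactly one more edge than vertices. -/
def IsBicyclic {V : Type*} [Fintype V] (G : SimpleGraph V) : Prop :=
  G.Connected ∧ G.edgeSet.ncard = Fintype.card V + 1

/-- The graph `G[p, q, r]` (for `p, q ≥ 3`, `r ≥ 1`): disjoint cycles `C_p`, `C_q` and a path `P_r`,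
with one end of the path identified with a vertex of `C_p` and the other end identified with a
vertex of `C_q`. Vertices are numbered so that `C_p` is on `0, …, p-1`, the path is on
`p-1, …, p+r-2`, and `C_q` is on `p+r-2, …, p+q+r-3`; so consecutive numbers are adjacent, and two
further edges close up the cycles. For `r = 1` the two cycles share exactly one vertex. -/
def twoCyclesPath (p q r : ℕ) : SimpleGraph (Fin (p + q + r - 2)) :=
  fromRel fun i j =>
    (i : ℕ) + 1 = (j : ℕ) ∨
    ((i : ℕ) = 0 ∧ (j : ℕ) + 1 = p) ∨
    ((i : ℕ) + 2 = p + r ∧ (j : ℕ) + 3 = p + q + r)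

/-- The graph `L_n = G[3, 3, n - 4]` (for `n ≥ 5`), which has `n` vertices. -/
def graphL (n : ℕ) : SimpleGraph (Fin (3 + 3 + (n - 4) - 2)) :=
  twoCyclesPath 3 3 (n - 4)

/-- The graph `A_n` (for `n ≥ 4`): the complete graph on `0, 1, 2, 3` without the edge `{0, 3}`, and
the path `3, 4, …, n-1` on `n - 3` vertices attached at the vertex `3`, of degree two in the
former graph. -/
def graphA (n : ℕ) : SimpleGraph (Fin n) :=
  fromRel fun i j =>
    (i : ℕ) + 1 = (j : ℕ) ∨
    ((i : ℕ) = 0 ∧ (j : ℕ) = 2) ∨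
    ((i : ℕ) = 1 ∧ (j : ℕ) = 3)

end SimpleGraph

/-!
Connected sets are counted by removing a vertex `v` that is not a cut vertex: the number of
connected sets of `G` is the number of those of `G - v` plus the number of those containing `v`.
Everything takes place inside one ambient graph, for vertex sets `A` with `a` elements.

The rooted numbers are bounded first. A connected `A` has at least `a` connected subsets containing
a given vertex; if that vertex has two neighbours, `A` splits into two connected sets sharing only
the vertex, connected sets on the two sides combine freely (`card_mul_card_add_le`), and there are
at least `2 (a - 1)`; with three neighbours there are at least `4 (a - 2)`. Walking along the
pendant path that starts at the root, this yields at least `a + 1` if `A` contains a cycle, with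
equality only for a path leading from the root to a triangle (`exists_lollipop_labelling`), and at
least `a + 3` if `A` has two edges more than a spanning tree. Summing up, connected sets that
contain a cycle have at least `a (a + 1) / 2 + a - 2` connected subsets, and arbitrary connected
sets at least `a (a + 1) / 2`.

In a bicyclic graph with `n ≥ 6` vertices a vertex `v` that is not a cut vertex has degree one, two
or three (`IsConnSet.bicyclic_step`). Degree one gives a strict inequality by induction, and degree
three gives one because `4 (n - 2)` is large. For degree two the claim is that at least `2 n`
connected sets contain `v`, with equality only for `L_n`. To see it, split the graph at `v`: the two
edges beyond a spanning tree lie on one side, where they raise one of the factors, or run between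
the sides, where they produce connected sets that the product does not count. Equality leaves only
a side consisting of `v` and one neighbour, the other side being a path from `v` to a triangle.

The graphs with five vertices are treated separately (`IsConnSet.bicyclic_five`), according to
whether there is a pendant vertex, and otherwise a vertex of degree four. The lower bound applied to
`L_n` itself leaves only an upper bound for the number of its connected sets to be proved: each is
one of an explicit list (`map_mem_graphLConnSets`).
-/

/-! ### Connected vertex sets -/

namespace SimpleGraph

variable {V : Type*} {G : SimpleGraph V}

/-- `S` is nonempty and every nonempty proper part of it has an edge to the rest of `S`; this says
that `S` induces a connected subgraph, see `isConnSet_iff_induce_connected`. -/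
def IsConnSet (G : SimpleGraph V) (S : Finset V) : Prop :=
  S.Nonempty ∧ ∀ T ⊆ S, T.Nonempty → T ≠ S → ∃ a ∈ T, ∃ b ∈ S, b ∉ T ∧ G.Adj a b

theorem isConnSet_singleton (v : V) : G.IsConnSet {v} := by
  refine ⟨Finset.singleton_nonempty v, fun T hT hne hTS => ?_⟩
  rcases Finset.subset_singleton_iff.1 hT with h | h
  · simp [h] at hne
  · exact absurd h hTS

theorem IsConnSet.exists_adj {S : Finset V} (hS : G.IsConnSet S) {v : V} (hv : v ∈ S)
    (h : 2 ≤ S.card) : ∃ w ∈ S, G.Adj v w := by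
  obtain ⟨a, ha, b, hb, -, hab⟩ := hS.2 {v} (by simpa using hv) (by simp)
    (fun h' => by rw [← h'] at h; simp at h)
  exact ⟨b, hb, Finset.mem_singleton.1 ha ▸ hab⟩

variable [DecidableEq V]

theorem IsConnSet.insert_adj {S : Finset V} (hS : G.IsConnSet S) {u w : V} (hw : w ∈ S)
    (h : G.Adj w u) : G.IsConnSet (insert u S) := by
  by_cases hu : u ∈ S
  · rwa [Finset.insert_eq_of_mem hu]
  refine ⟨Finset.insert_nonempty u S, fun T hT hne hTS => ?_⟩
  by_cases hST : S ⊆ T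
  · have huT : u ∉ T := fun huT => hTS (hT.antisymm (Finset.insert_subset huT hST))
    exact ⟨w, hST hw, u, Finset.mem_insert_self u S, huT, h⟩
  by_cases hTn : (T ∩ S).Nonempty
  · obtain ⟨a, ha, b, hb, hbT, hab⟩ := hS.2 (T ∩ S) Finset.inter_subset_right hTn
      (fun h => hST (Finset.inter_eq_right.1 h))
    rw [Finset.mem_inter] at ha hbT
    exact ⟨a, ha.1, b, Finset.mem_insert_of_mem hb, fun h => hbT ⟨h, hb⟩, hab⟩
  · rw [Finset.not_nonempty_iff_eq_empty, ← Finset.disjoint_iff_inter_eq_empty] at hTn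
    obtain ⟨t, ht⟩ := hne
    have htu : t = u := (Finset.mem_insert.1 (hT ht)).resolve_right
      (fun h => Finset.disjoint_left.1 hTn ht h)
    exact ⟨u, htu ▸ ht, w, Finset.mem_insert_of_mem hw,
      fun h => Finset.disjoint_left.1 hTn h hw, h.symm⟩

theorem IsConnSet.union {S T : Finset V} (hS : G.IsConnSet S) (hT : G.IsConnSet T) {v : V}
    (hvS : v ∈ S) (hvT : v ∈ T) : G.IsConnSet (S ∪ T) := by
  refine ⟨⟨v, Finset.mem_union_left _ hvS⟩, fun U hU hne hUne => ?_⟩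
  -- a proper part of a connected set that meets it has an edge leaving it
  have key : ∀ W, G.IsConnSet W → (U ∩ W).Nonempty → ¬ W ⊆ U →
      ∃ a ∈ U, ∃ b ∈ W, b ∉ U ∧ G.Adj a b := by
    intro W hW h1 h2
    obtain ⟨a, ha, b, hb, hbT, hab⟩ := hW.2 (U ∩ W) Finset.inter_subset_right h1
      (fun h => h2 (Finset.inter_eq_right.1 h))
    rw [Finset.mem_inter] at ha hbT
    exact ⟨a, ha.1, b, hb, fun h => hbT ⟨h, hb⟩, hab⟩
  by_cases hv : v ∈ U
  · by_cases h : S ⊆ U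
    · by_cases h' : T ⊆ U
      · exact absurd (hU.antisymm (Finset.union_subset h h')) hUne
      · obtain ⟨a, ha, b, hb, h⟩ := key T hT ⟨v, Finset.mem_inter.2 ⟨hv, hvT⟩⟩ h'
        exact ⟨a, ha, b, Finset.mem_union_right _ hb, h⟩
    · obtain ⟨a, ha, b, hb, h⟩ := key S hS ⟨v, Finset.mem_inter.2 ⟨hv, hvS⟩⟩ h
      exact ⟨a, ha, b, Finset.mem_union_left _ hb, h⟩
  · obtain ⟨t, ht⟩ := hne
    rcases Finset.mem_union.1 (hU ht) with h | h
    · obtain ⟨a, ha, b, hb, h⟩ := key S hS ⟨t, Finset.mem_inter.2 ⟨ht, h⟩⟩ (fun h => hv (h hvS))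
      exact ⟨a, ha, b, Finset.mem_union_left _ hb, h⟩
    · obtain ⟨a, ha, b, hb, h⟩ := key T hT ⟨t, Finset.mem_inter.2 ⟨ht, h⟩⟩ (fun h => hv (h hvT))
      exact ⟨a, ha, b, Finset.mem_union_right _ hb, h⟩

theorem isConnSet_pair {u v : V} (h : G.Adj u v) : G.IsConnSet {u, v} := by
  rw [Finset.pair_comm]; exact (isConnSet_singleton u).insert_adj (Finset.mem_singleton_self u) h

theorem isConnSet_triple {u v w : V} (h : G.Adj u v) (h' : G.Adj u w) :
    G.IsConnSet {u, v, w} := by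
  have := (isConnSet_pair h').insert_adj (u := v) (by simp) h
  rwa [Finset.insert_comm] at this

/-- A connected set grown inside `S` until one vertex is missing: the last vertex is not a cut
vertex, and it can be chosen outside any connected `R`. -/
theorem IsConnSet.exists_erase {S R : Finset V} (hS : G.IsConnSet S) (hR : G.IsConnSet R)
    (hRS : R ⊂ S) : ∃ u ∈ S, u ∉ R ∧ G.IsConnSet (S.erase u) := by
  induction hk : S.card - R.card using Nat.strong_induction_on generalizing R with
  | _ k ih =>
    obtain ⟨a, ha, b, hb, hbR, hab⟩ := hS.2 R hRS.1 hR.1 hRS.ne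
    have hR' := hR.insert_adj ha hab
    by_cases h : insert b R = S
    · refine ⟨b, hb, hbR, ?_⟩
      rwa [← h, Finset.erase_insert hbR]
    · have hss : insert b R ⊂ S := (Finset.insert_subset hb hRS.1).ssubset_of_ne h
      have h1 := Finset.card_lt_card hss
      have h2 := Finset.card_insert_of_notMem hbR
      obtain ⟨u, hu, huR, h⟩ := ih (S.card - (insert b R).card) (by omega) hR' hss rfl
      exact ⟨u, hu, fun h => huR (Finset.mem_insert_of_mem h), h⟩

theorem IsConnSet.exists_ne_erase {S : Finset V} (hS : G.IsConnSet S) {v : V} (hv : v ∈ S)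
    (h : 2 ≤ S.card) : ∃ u ∈ S, u ≠ v ∧ G.IsConnSet (S.erase u) := by
  obtain ⟨u, hu, huv, h⟩ := hS.exists_erase (isConnSet_singleton v)
    ((Finset.singleton_subset_iff.2 hv).ssubset_of_ne (fun h' => by rw [← h'] at h; simp at h))
  exact ⟨u, hu, by simpa using huv, h⟩

theorem IsConnSet.erase_of_unique_adj {S : Finset V} (hS : G.IsConnSet S) {v w : V}
    (hw : w ∈ S) (hvw : G.Adj v w) (huniq : ∀ u ∈ S, G.Adj v u → u = w) :
    G.IsConnSet (S.erase v) := by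
  have hwv : w ∈ S.erase v := Finset.mem_erase.2 ⟨hvw.ne', hw⟩
  refine ⟨⟨w, hwv⟩, fun T hT hne hTS => ?_⟩
  have hvT : v ∉ T := fun h => Finset.notMem_erase v S (hT h)
  have hTS' : T ⊆ S := hT.trans (Finset.erase_subset _ _)
  by_cases hwT : w ∈ T
  · by_cases hv : v ∈ S
    · obtain ⟨a, ha, b, hb, hbT, hab⟩ := hS.2 (insert v T) (Finset.insert_subset hv hTS')
        (Finset.insert_nonempty _ _) (fun h => hTS (by rw [← h, Finset.erase_insert hvT]))
      rw [Finset.mem_insert, not_or] at hbT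
      rcases Finset.mem_insert.1 ha with rfl | ha
      · exact absurd (huniq b hb hab ▸ hwT) hbT.2
      · exact ⟨a, ha, b, Finset.mem_erase.2 ⟨hbT.1, hb⟩, hbT.2, hab⟩
    · rw [Finset.erase_eq_of_notMem hv] at hTS ⊢
      exact hS.2 T hTS' hne hTS
  · obtain ⟨a, ha, b, hb, hbT, hab⟩ := hS.2 T hTS' hne
      (fun h => hwT (h ▸ hw))
    refine ⟨a, ha, b, Finset.mem_erase.2 ⟨?_, hb⟩, hbT, hab⟩
    rintro rfl
    exact hwT (huniq a (hTS' ha) hab.symm ▸ ha)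

/-- Two connected sets that share only `v` grow to two connected sets that share only `v` and
cover the whole of a connected set `C`. -/
theorem IsConnSet.exists_extend {C A₀ B₀ : Finset V} {v : V} (hC : G.IsConnSet C)
    (hA : G.IsConnSet A₀) (hB : G.IsConnSet B₀) (hAC : A₀ ⊆ C) (hBC : B₀ ⊆ C)
    (hAB : A₀ ∩ B₀ = {v}) : ∃ A B, A₀ ⊆ A ∧ B₀ ⊆ B ∧ G.IsConnSet A ∧ G.IsConnSet B ∧
      A ∩ B = {v} ∧ A ∪ B = C := by
  induction hk : C.card - (A₀ ∪ B₀).card using Nat.strong_induction_on generalizing A₀ B₀ with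
  | _ k ih =>
    by_cases h : A₀ ∪ B₀ = C
    · exact ⟨A₀, B₀, subset_rfl, subset_rfl, hA, hB, hAB, h⟩
    have hss := Finset.union_subset hAC hBC
    obtain ⟨a, ha, b, hb, hbR, hab⟩ := hC.2 _ hss (hA.1.mono Finset.subset_union_left) h
    have h1 := Finset.card_lt_card (hss.ssubset_of_ne h)
    have h2 := Finset.card_insert_of_notMem hbR
    rw [Finset.mem_union, not_or] at hbR
    rcases Finset.mem_union.1 ha with ha | ha
    · obtain ⟨A, B, hA', hB', h⟩ := ih (C.card - (insert b A₀ ∪ B₀).card)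
        (by rw [Finset.insert_union]; omega) (hA.insert_adj ha hab) hB
        (Finset.insert_subset hb hAC) hBC (by rw [Finset.insert_inter_of_notMem hbR.2, hAB]) rfl
      exact ⟨A, B, (Finset.subset_insert _ _).trans hA', hB', h⟩
    · obtain ⟨A, B, hA', hB', h⟩ := ih (C.card - (A₀ ∪ insert b B₀).card)
        (by rw [Finset.union_insert]; omega) hA (hB.insert_adj ha hab)
        hAC (Finset.insert_subset hb hBC) (by rw [Finset.inter_insert_of_notMem hbR.1, hAB]) rfl
      exact ⟨A, B, hA', (Finset.subset_insert _ _).trans hB', h⟩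

theorem isConnSet_iff_induce_connected (S : Finset V) :
    G.IsConnSet S ↔ (G.induce (S : Set V)).Connected := by
  constructor
  · rintro ⟨⟨r, hr⟩, h⟩
    rw [connected_iff_exists_forall_reachable]
    refine ⟨⟨r, hr⟩, ?_⟩
    by_contra! hcon
    obtain ⟨⟨w, hw⟩, hwr⟩ := hcon
    classical
    obtain ⟨a, ha, b, hb, hbT, hab⟩ := h
      (S.filter fun x => ∃ hx : x ∈ S, (G.induce (S : Set V)).Reachable ⟨r, hr⟩ ⟨x, hx⟩)
      (Finset.filter_subset _ _) ⟨r, Finset.mem_filter.2 ⟨hr, hr, Reachable.refl _⟩⟩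
      (fun h => by
        rw [← h] at hw
        exact hwr (Finset.mem_filter.1 hw).2.2)
    obtain ⟨_, _, har⟩ := Finset.mem_filter.1 ha
    refine hbT (Finset.mem_filter.2 ⟨hb, hb, har.trans (Adj.reachable ?_)⟩)
    exact hab
  · intro h
    obtain ⟨⟨r, hr⟩⟩ := h.nonempty
    refine ⟨⟨r, hr⟩, fun T hT ⟨t, ht⟩ hTS => ?_⟩
    obtain ⟨s, hs, hsT⟩ := Finset.exists_of_ssubset (hT.ssubset_of_ne hTS)
    obtain ⟨p⟩ := h.preconnected ⟨t, hT ht⟩ ⟨s, hs⟩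
    obtain ⟨d, -, h1, h2⟩ := p.exists_boundary_dart {x | x.1 ∈ T} ht hsT
    exact ⟨_, h1, _, d.snd.2, h2, d.adj⟩

end SimpleGraph

/-! ### Counting edges and connected subsets -/

namespace SimpleGraph

variable {V : Type*} {G : SimpleGraph V}

open Classical in
/-- The number of adjacent pairs in `A × B`. Thus `adjCount A A` is twice the number of edges inside
`A`, and `adjCount {v} A` is the number of neighbours of `v` in `A`. -/
noncomputable def adjCount (G : SimpleGraph V) (A B : Finset V) : ℕ :=
  ∑ a ∈ A, ∑ b ∈ B, if G.Adj a b then 1 else 0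

theorem adjCount_comm (A B : Finset V) : G.adjCount A B = G.adjCount B A := by
  classical
  unfold adjCount
  rw [Finset.sum_comm]
  exact Finset.sum_congr rfl fun b _ => Finset.sum_congr rfl fun a _ =>
    if_congr (G.adj_comm a b) rfl rfl

theorem exists_adj_of_adjCount_pos {A B : Finset V} (h : 0 < G.adjCount A B) :
    ∃ a ∈ A, ∃ b ∈ B, G.Adj a b := by
  contrapose! h
  refine le_of_eq (Finset.sum_eq_zero fun a ha => Finset.sum_eq_zero fun b hb => ?_)
  rw [if_neg (h a ha b hb)]

theorem adjCount_pos {A B : Finset V} {a b : V} (ha : a ∈ A) (hb : b ∈ B) (h : G.Adj a b) :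
    0 < G.adjCount A B := by
  classical
  unfold adjCount
  refine Finset.sum_pos' (fun _ _ => Nat.zero_le _) ⟨a, ha, ?_⟩
  exact Finset.sum_pos' (fun _ _ => Nat.zero_le _) ⟨b, hb, by simp [h]⟩

theorem adjCount_self_le (A : Finset V) : G.adjCount A A ≤ A.card * (A.card - 1) := by
  classical
  unfold adjCount
  rw [← smul_eq_mul]
  refine Finset.sum_le_card_nsmul _ _ _ fun a ha => ?_
  rw [← Finset.card_filter, ← Finset.card_erase_of_mem ha]
  refine Finset.card_le_card fun b hb => ?_
  rw [Finset.mem_filter] at hb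
  exact Finset.mem_erase.2 ⟨hb.2.ne', hb.1⟩

@[simp] theorem adjCount_singleton_self (v : V) : G.adjCount {v} {v} = 0 := by
  simp [adjCount]

open Classical in
theorem adjCount_singleton_left (v : V) (B : Finset V) :
    G.adjCount {v} B = (B.filter (G.Adj v)).card := by
  simp [adjCount]

theorem eq_of_adjCount_le_one {v w u : V} {B : Finset V} (h : G.adjCount {v} B ≤ 1)
    (hw : w ∈ B) (hvw : G.Adj v w) (hu : u ∈ B) (hvu : G.Adj v u) : u = w := by
  classical
  rw [adjCount_singleton_left] at h
  exact Finset.card_le_one.1 h u (Finset.mem_filter.2 ⟨hu, hvu⟩) w (Finset.mem_filter.2 ⟨hw, hvw⟩)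

theorem adjCount_singleton_lt {v : V} {B : Finset V} (hv : v ∈ B) :
    G.adjCount {v} B < B.card := by
  classical
  rw [adjCount_singleton_left]
  refine Finset.card_lt_card ((Finset.filter_ssubset).2 ⟨v, hv, G.loopless.irrefl v⟩)

/-- Every ordered pair of distinct non-adjacent vertices is missing from the count. -/
theorem adjCount_self_add_card_le {A : Finset V} (T : Finset (V × V))
    (hT : ∀ p ∈ T, p.1 ∈ A ∧ p.2 ∈ A ∧ p.1 ≠ p.2 ∧ ¬ G.Adj p.1 p.2) :
    G.adjCount A A + T.card ≤ A.card * (A.card - 1) := by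
  classical
  have h1 : G.adjCount A A = (A.offDiag.filter fun p => G.Adj p.1 p.2).card := by
    rw [adjCount, ← Finset.sum_product', ← Finset.card_filter]
    congr 1
    ext p
    simp only [Finset.mem_filter, Finset.mem_product, Finset.mem_offDiag]
    exact ⟨fun h => ⟨⟨h.1.1, h.1.2, h.2.ne⟩, h.2⟩, fun h => ⟨⟨h.1.1, h.1.2.1⟩, h.2⟩⟩
  have h2 : A.card * (A.card - 1) = A.offDiag.card := by
    rw [Finset.offDiag_card, Nat.mul_sub_one]
  rw [h1, h2, ← Finset.card_union_of_disjoint]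
  · refine Finset.card_le_card (Finset.union_subset (Finset.filter_subset _ _) fun p hp => ?_)
    obtain ⟨h1, h2, h3, -⟩ := hT p hp
    exact Finset.mem_offDiag.2 ⟨h1, h2, h3⟩
  · exact Finset.disjoint_left.2 fun p hp hp' => (hT p hp').2.2.2 (Finset.mem_filter.1 hp).2

theorem adj_of_card_le_adjCount {v w : V} {B : Finset V} (h : B.card ≤ G.adjCount {v} B)
    (hw : w ∈ B) : G.Adj v w := by
  classical
  rw [adjCount_singleton_left] at h
  have := Finset.eq_of_subset_of_card_le (Finset.filter_subset (G.Adj v) B) h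
  rw [← this] at hw
  exact (Finset.mem_filter.1 hw).2

theorem exists_two_of_adjCount {v : V} {B : Finset V} (h : 2 ≤ G.adjCount {v} B) :
    ∃ x ∈ B, ∃ y ∈ B, x ≠ y ∧ G.Adj v x ∧ G.Adj v y := by
  classical
  rw [adjCount_singleton_left] at h
  obtain ⟨x, hx, y, hy, hxy⟩ := Finset.one_lt_card.1 h
  rw [Finset.mem_filter] at hx hy
  exact ⟨x, hx.1, y, hy.1, hxy, hx.2, hy.2⟩

theorem exists_three_of_adjCount {v : V} {B : Finset V} (h : 3 ≤ G.adjCount {v} B) :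
    ∃ x ∈ B, ∃ y ∈ B, ∃ z ∈ B, x ≠ y ∧ x ≠ z ∧ y ≠ z ∧ G.Adj v x ∧ G.Adj v y ∧ G.Adj v z := by
  classical
  rw [adjCount_singleton_left] at h
  obtain ⟨x, y, z, hx, hy, hz, h1, h2, h3⟩ := Finset.two_lt_card_iff.1 h
  rw [Finset.mem_filter] at hx hy hz
  exact ⟨x, hx.1, y, hy.1, z, hz.1, h1, h2, h3, hx.2, hy.2, hz.2⟩

theorem eq_or_eq_of_adjCount_le_two {v x y u : V} {B : Finset V} (h : G.adjCount {v} B ≤ 2)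
    (hx : x ∈ B) (hy : y ∈ B) (hxy : x ≠ y) (hvx : G.Adj v x) (hvy : G.Adj v y)
    (hu : u ∈ B) (hvu : G.Adj v u) : u = x ∨ u = y := by
  classical
  rw [adjCount_singleton_left] at h
  by_contra! hcon
  refine absurd (Finset.two_lt_card_iff.2 ⟨u, x, y, ?_, ?_, ?_, hcon.1, hcon.2, hxy⟩) (not_lt.2 h)
  all_goals rw [Finset.mem_filter]
  exacts [⟨hu, hvu⟩, ⟨hx, hvx⟩, ⟨hy, hvy⟩]

open Classical in
/-- The connected sets contained in `A`. -/
noncomputable def connSubsets (G : SimpleGraph V) (A : Finset V) : Finset (Finset V) :=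
  A.powerset.filter G.IsConnSet

open Classical in
/-- The connected sets contained in `A` that contain the vertex `v`. -/
noncomputable def connSubsetsAt (G : SimpleGraph V) (A : Finset V) (v : V) : Finset (Finset V) :=
  A.powerset.filter fun S => v ∈ S ∧ G.IsConnSet S

theorem mem_connSubsets {A S : Finset V} : S ∈ G.connSubsets A ↔ S ⊆ A ∧ G.IsConnSet S := by
  simp [connSubsets]

theorem mem_connSubsetsAt {A S : Finset V} {v : V} :
    S ∈ G.connSubsetsAt A v ↔ S ⊆ A ∧ v ∈ S ∧ G.IsConnSet S := by
  simp [connSubsetsAt]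

theorem connSubsets_mono {A B : Finset V} (h : A ⊆ B) : G.connSubsets A ⊆ G.connSubsets B :=
  fun S hS => by
  rw [mem_connSubsets] at hS ⊢
  exact ⟨hS.1.trans h, hS.2⟩

theorem connSubsetsAt_mono {A B : Finset V} (h : A ⊆ B) (v : V) :
    G.connSubsetsAt A v ⊆ G.connSubsetsAt B v := fun S hS => by
  rw [mem_connSubsetsAt] at hS ⊢
  exact ⟨hS.1.trans h, hS.2⟩

variable [DecidableEq V]

theorem adjCount_union_left {A B : Finset V} (h : Disjoint A B) (C : Finset V) :
    G.adjCount (A ∪ B) C = G.adjCount A C + G.adjCount B C :=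
  Finset.sum_union h

theorem adjCount_union_right {A B : Finset V} (h : Disjoint A B) (C : Finset V) :
    G.adjCount C (A ∪ B) = G.adjCount C A + G.adjCount C B := by
  rw [adjCount_comm, adjCount_union_left h, adjCount_comm A, adjCount_comm B]

theorem adjCount_union_self {A B : Finset V} (h : Disjoint A B) :
    G.adjCount (A ∪ B) (A ∪ B) = G.adjCount A A + G.adjCount B B + 2 * G.adjCount A B := by
  rw [adjCount_union_left h, adjCount_union_right h, adjCount_union_right h, adjCount_comm B A]
  ring

theorem adjCount_self_eq_erase {A : Finset V} {v : V} (hv : v ∈ A) :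
    G.adjCount A A = G.adjCount (A.erase v) (A.erase v) + 2 * G.adjCount {v} A := by
  have hd : Disjoint {v} (A.erase v) := by simp
  have hA : {v} ∪ A.erase v = A := by
    rw [← Finset.insert_eq, Finset.insert_erase hv]
  have h1 := adjCount_union_self (G := G) hd
  have h2 := adjCount_union_right (G := G) hd {v}
  rw [hA] at h1 h2
  rw [adjCount_singleton_self] at h1 h2
  omega

theorem even_adjCount_self (A : Finset V) : Even (G.adjCount A A) := by
  induction A using Finset.induction_on with
  | empty => simp [adjCount]
  | insert a s ha ih =>
    rw [adjCount_self_eq_erase (Finset.mem_insert_self a s), Finset.erase_insert ha]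
    exact ih.add (even_two_mul _)

theorem exists_adj_ne_of_two_le_adjCount {X Y : Finset V} {x y : V} (h : 2 ≤ G.adjCount X Y)
    (hx : x ∈ X) : ∃ p ∈ X, ∃ q ∈ Y, G.Adj p q ∧ (p ≠ x ∨ q ≠ y) := by
  have h1 := adjCount_union_left (G := G) (A := {x}) (B := X.erase x) (by simp) Y
  rw [← Finset.insert_eq, Finset.insert_erase hx] at h1
  by_cases h2 : 0 < G.adjCount (X.erase x) Y
  · obtain ⟨p, hp, q, hq, hpq⟩ := exists_adj_of_adjCount_pos h2
    rw [Finset.mem_erase] at hp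
    exact ⟨p, hp.2, q, hq, hpq, Or.inl hp.1⟩
  · obtain ⟨q, hq, q', hq', hne, h3, h4⟩ :=
      exists_two_of_adjCount (G := G) (v := x) (B := Y) (by omega)
    by_cases hqy : q = y
    · exact ⟨x, hx, q', hq', h4, Or.inr fun h => hne (hqy.trans h.symm)⟩
    · exact ⟨x, hx, q, hq, h3, Or.inr hqy⟩

/-- A connected set spans at least one edge less than it has vertices. -/
theorem IsConnSet.le_adjCount {A : Finset V} (hA : G.IsConnSet A) :
    2 * A.card ≤ G.adjCount A A + 2 := by
  induction hk : A.card using Nat.strong_induction_on generalizing A with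
  | _ k ih =>
    obtain ⟨v, hv⟩ := hA.1
    by_cases h2 : 2 ≤ A.card
    · obtain ⟨u, hu, -, h⟩ := hA.exists_ne_erase hv h2
      obtain ⟨w, hw, huw⟩ := hA.exists_adj hu h2
      have h1 := adjCount_pos (Finset.mem_singleton_self u) hw huw
      have h3 := adjCount_self_eq_erase (G := G) hu
      have h4 := Finset.card_erase_of_mem hu
      have h5 := ih (A.erase u).card (by omega) h rfl
      omega
    · omega

theorem card_connSubsets_eq {A : Finset V} {v : V} :
    (G.connSubsets A).card = (G.connSubsets (A.erase v)).card + (G.connSubsetsAt A v).card := by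
  rw [← Finset.card_union_of_disjoint]
  · congr 1
    ext S
    simp only [Finset.mem_union, mem_connSubsets, mem_connSubsetsAt, Finset.subset_erase]
    tauto
  · rw [Finset.disjoint_left]
    intro S h1 h2
    rw [mem_connSubsets, Finset.subset_erase] at h1
    exact h1.1.2 (mem_connSubsetsAt.1 h2).2.1

theorem IsConnSet.card_le_connSubsetsAt {A : Finset V} (hA : G.IsConnSet A) {v : V} (hv : v ∈ A) :
    A.card ≤ (G.connSubsetsAt A v).card := by
  induction hk : A.card using Nat.strong_induction_on generalizing A with
  | _ k ih =>
    by_cases h2 : 2 ≤ A.card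
    · obtain ⟨u, hu, huv, h⟩ := hA.exists_ne_erase hv h2
      have h4 := Finset.card_erase_of_mem hu
      have h5 := ih (A.erase u).card (by omega) h (Finset.mem_erase.2 ⟨huv.symm, hv⟩) rfl
      have hss : G.connSubsetsAt (A.erase u) v ⊂ G.connSubsetsAt A v :=
        (Finset.ssubset_iff_of_subset (connSubsetsAt_mono (Finset.erase_subset _ _) v)).2
          ⟨A, mem_connSubsetsAt.2 ⟨subset_rfl, hv, hA⟩, fun h => by
            have := (mem_connSubsetsAt.1 h).1 hu
            simp at this⟩
      have := Finset.card_lt_card hss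
      omega
    · have : 0 < (G.connSubsetsAt A v).card :=
        Finset.card_pos.2 ⟨A, mem_connSubsetsAt.2 ⟨subset_rfl, hv, hA⟩⟩
      omega

theorem IsConnSet.card_mul_le_two_connSubsets {A : Finset V} (hA : G.IsConnSet A) :
    A.card * (A.card + 1) ≤ 2 * (G.connSubsets A).card := by
  induction hk : A.card using Nat.strong_induction_on generalizing A with
  | _ k ih =>
    obtain ⟨v, hv⟩ := hA.1
    by_cases h2 : 2 ≤ A.card
    · obtain ⟨u, hu, huv, h⟩ := hA.exists_ne_erase hv h2
      have h4 := Finset.card_erase_of_mem hu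
      have h5 := ih (A.erase u).card (by omega) h rfl
      have h6 := hA.card_le_connSubsetsAt hu
      rw [card_connSubsets_eq (v := u)]
      obtain ⟨m, rfl⟩ : ∃ m, k = m + 1 := ⟨k - 1, by omega⟩
      rw [h4, hk, Nat.add_sub_cancel] at h5
      nlinarith
    · have : 0 < (G.connSubsets A).card :=
        Finset.card_pos.2 ⟨A, mem_connSubsets.2 ⟨subset_rfl, hA⟩⟩
      have : k ≤ 1 := by omega
      interval_cases k <;> omega

/-- Connected sets containing `v` on the two sides of a splitting combine freely; the sets in `X`
are further connected sets, whose trace on one of the sides is disconnected. -/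
theorem card_mul_card_add_le {A B C : Finset V} {v : V} (hAB : A ∩ B = {v}) (hC : A ∪ B = C)
    (X : Finset (Finset V)) (hX : ∀ S ∈ X, S ⊆ C ∧ v ∈ S ∧ G.IsConnSet S ∧
      ¬ (G.IsConnSet (S ∩ A) ∧ G.IsConnSet (S ∩ B))) :
    (G.connSubsetsAt A v).card * (G.connSubsetsAt B v).card + X.card ≤
      (G.connSubsetsAt C v).card := by
  have key : ∀ S ∈ G.connSubsetsAt A v, ∀ T ∈ G.connSubsetsAt B v,
      (S ∪ T) ∩ A = S ∧ (S ∪ T) ∩ B = T := by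
    intro S hS T hT
    rw [mem_connSubsetsAt] at hS hT
    have h1 : ∀ x, x ∈ A → x ∈ B → x = v := fun x ha hb => by
      have : x ∈ A ∩ B := Finset.mem_inter.2 ⟨ha, hb⟩
      rw [hAB] at this; simpa using this
    constructor
    · ext x
      simp only [Finset.mem_inter, Finset.mem_union]
      constructor
      · rintro ⟨h | h, hx⟩
        · exact h
        · rw [h1 x hx (hT.1 h)]; exact hS.2.1
      · exact fun h => ⟨Or.inl h, hS.1 h⟩
    · ext x
      simp only [Finset.mem_inter, Finset.mem_union]
      constructor
      · rintro ⟨h | h, hx⟩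
        · rw [h1 x (hS.1 h) hx]; exact hT.2.1
        · exact h
      · exact fun h => ⟨Or.inr h, hT.1 h⟩
  have hinj : Set.InjOn (fun p : Finset V × Finset V => p.1 ∪ p.2)
      (G.connSubsetsAt A v ×ˢ G.connSubsetsAt B v : Finset _) := by
    rintro ⟨S, T⟩ h ⟨S', T'⟩ h' heq
    rw [Finset.coe_product, Set.mem_prod] at h h'
    obtain ⟨h1, h2⟩ := key S h.1 T h.2
    obtain ⟨h3, h4⟩ := key S' h'.1 T' h'.2
    simp only at heq
    rw [heq] at h1 h2
    rw [← h1, ← h2, h3, h4]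
  rw [← Finset.card_product, ← Finset.card_image_of_injOn hinj, ← Finset.card_union_of_disjoint]
  · refine Finset.card_le_card (Finset.union_subset (fun S hS => ?_) fun S hS => ?_)
    · obtain ⟨⟨S, T⟩, h, rfl⟩ := Finset.mem_image.1 hS
      rw [Finset.mem_product, mem_connSubsetsAt, mem_connSubsetsAt] at h
      rw [mem_connSubsetsAt, ← hC]
      exact ⟨Finset.union_subset_union h.1.1 h.2.1, Finset.mem_union_left _ h.1.2.1,
        h.1.2.2.union h.2.2.2 h.1.2.1 h.2.2.1⟩
    · obtain ⟨h1, h2, h3, -⟩ := hX S hS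
      exact mem_connSubsetsAt.2 ⟨h1, h2, h3⟩
  · rw [Finset.disjoint_left]
    intro S hS hSX
    obtain ⟨⟨S, T⟩, h, rfl⟩ := Finset.mem_image.1 hS
    rw [Finset.mem_product] at h
    obtain ⟨h1, h2⟩ := key S h.1 T h.2
    refine (hX _ hSX).2.2.2 ?_
    simp only [h1, h2]
    exact ⟨(mem_connSubsetsAt.1 h.1).2.2, (mem_connSubsetsAt.1 h.2).2.2⟩

theorem card_mul_card_le {A B C : Finset V} {v : V} (hAB : A ∩ B = {v}) (hC : A ∪ B = C) :
    (G.connSubsetsAt A v).card * (G.connSubsetsAt B v).card ≤ (G.connSubsetsAt C v).card := by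
  simpa using card_mul_card_add_le (G := G) hAB hC ∅ (by simp)

theorem card_add_card_of_inter_eq_singleton {A B C : Finset V} {v : V} (hAB : A ∩ B = {v})
    (hC : A ∪ B = C) : A.card + B.card = C.card + 1 := by
  rw [← Finset.card_union_add_card_inter, hAB, hC, Finset.card_singleton]

/-- With `a + b = n + 1` and `a, b ≥ 2` the product `a * b` is at least `2 * (n - 1)`. -/
theorem IsConnSet.two_mul_le_connSubsetsAt {C : Finset V} (hC : G.IsConnSet C) {v x y : V}
    (hv : v ∈ C) (hx : x ∈ C) (hy : y ∈ C) (hxy : x ≠ y) (hvx : G.Adj v x) (hvy : G.Adj v y) :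
    2 * C.card ≤ (G.connSubsetsAt C v).card + 2 := by
  obtain ⟨A, B, hA, hB, hcA, hcB, hAB, hAC⟩ := hC.exists_extend (isConnSet_pair hvx)
    (isConnSet_pair hvy) (v := v) (by simp [Finset.insert_subset_iff, *])
    (by simp [Finset.insert_subset_iff, *])
    (by ext z; simp only [Finset.mem_inter, Finset.mem_insert, Finset.mem_singleton]; grind)
  have h1 := card_mul_card_le (G := G) hAB hAC
  have h2 := card_add_card_of_inter_eq_singleton hAB hAC
  have h3 := hcA.card_le_connSubsetsAt (hA (Finset.mem_insert_self v _))
  have h4 := hcB.card_le_connSubsetsAt (hB (Finset.mem_insert_self v _))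
  have h5 := Finset.card_le_card hA
  have h6 := Finset.card_le_card hB
  rw [Finset.card_pair hvx.ne] at h5
  rw [Finset.card_pair hvy.ne] at h6
  have h7 := Nat.mul_le_mul h3 h4
  nlinarith

/-- Two of the three neighbours go to one side, to which the bound for two neighbours applies. -/
theorem IsConnSet.four_mul_le_connSubsetsAt {C : Finset V} (hC : G.IsConnSet C) {v x y z : V}
    (hv : v ∈ C) (hx : x ∈ C) (hy : y ∈ C) (hz : z ∈ C) (hxy : x ≠ y) (hxz : x ≠ z) (hyz : y ≠ z)
    (hvx : G.Adj v x) (hvy : G.Adj v y) (hvz : G.Adj v z) :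
    4 * C.card ≤ (G.connSubsetsAt C v).card + 8 := by
  obtain ⟨A, B, hA, hB, hcA, hcB, hAB, hAC⟩ := hC.exists_extend (isConnSet_pair hvx)
    (isConnSet_triple hvy hvz) (v := v) (by simp [Finset.insert_subset_iff, *])
    (by simp [Finset.insert_subset_iff, *])
    (by ext z; simp only [Finset.mem_inter, Finset.mem_insert, Finset.mem_singleton]; grind)
  have h1 := card_mul_card_le (G := G) hAB hAC
  have h2 := card_add_card_of_inter_eq_singleton hAB hAC
  have h3 := hcA.card_le_connSubsetsAt (hA (Finset.mem_insert_self v _))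
  have h4 := hcB.two_mul_le_connSubsetsAt (hB (Finset.mem_insert_self v _)) (hB (by simp))
    (hB (by simp)) hyz hvy hvz
  have h5 := Finset.card_le_card hA
  have h6 := Finset.card_le_card hB
  rw [Finset.card_pair hvx.ne] at h5
  rw [Finset.card_eq_three.2 ⟨v, y, z, hvy.ne, hvz.ne, hyz, rfl⟩] at h6
  have h7 := Nat.mul_le_mul h3 (Nat.sub_le_of_le_add h4)
  obtain ⟨b, hb⟩ : ∃ b, B.card = b + 3 := ⟨B.card - 3, by omega⟩
  obtain ⟨a, ha⟩ : ∃ a, A.card = a + 2 := ⟨A.card - 2, by omega⟩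
  rw [ha, hb, show 2 * (b + 3) - 2 = 2 * b + 4 by omega] at h7
  nlinarith

/-- At a vertex with a single neighbour, removing the vertex moves the root to the neighbour. -/
theorem card_connSubsetsAt_erase_lt {A : Finset V} {v w : V} (hv : v ∈ A) (hvw : G.Adj v w) :
    (G.connSubsetsAt (A.erase v) w).card < (G.connSubsetsAt A v).card := by
  have hinj : Set.InjOn (fun S : Finset V => insert v S) (G.connSubsetsAt (A.erase v) w) := by
    intro S hS T hT h
    have h1 : v ∉ S := (Finset.subset_erase.1 (mem_connSubsetsAt.1 hS).1).2
    have h2 : v ∉ T := (Finset.subset_erase.1 (mem_connSubsetsAt.1 hT).1).2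
    simp only at h
    rw [← Finset.erase_insert h1, h, Finset.erase_insert h2]
  rw [← Finset.card_image_of_injOn hinj]
  refine Finset.card_lt_card ((Finset.ssubset_iff_of_subset fun S hS => ?_).2 ⟨{v}, ?_, ?_⟩)
  · obtain ⟨S, h, rfl⟩ := Finset.mem_image.1 hS
    rw [mem_connSubsetsAt] at h ⊢
    exact ⟨Finset.insert_subset hv (h.1.trans (Finset.erase_subset _ _)),
      Finset.mem_insert_self _ _, h.2.2.insert_adj h.2.1 hvw.symm⟩
  · simpa [mem_connSubsetsAt, hv] using isConnSet_singleton v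
  · intro h
    obtain ⟨S, h, h'⟩ := Finset.mem_image.1 h
    have hwS := (mem_connSubsetsAt.1 h).2.1
    have : w ∈ ({v} : Finset V) := h' ▸ Finset.mem_insert_of_mem hwS
    exact hvw.ne' (Finset.mem_singleton.1 this)

end SimpleGraph

/-! ### Lower bounds in the presence of cycles -/

namespace SimpleGraph

variable {V : Type*} {G : SimpleGraph V}

/-- `p` numbers the vertices of `A` by `0, …, |A| - 1` so that vertices numbered `i < j` are
adjacent exactly when `r i j`. The values of `p` from `|A|` on are irrelevant. -/
def IsLabelling (G : SimpleGraph V) (A : Finset V) (r : ℕ → ℕ → Prop) (p : ℕ → V) : Prop :=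
  (∀ i < A.card, p i ∈ A) ∧ Set.InjOn p (Set.Iio A.card) ∧
    ∀ i j, i < j → j < A.card → (G.Adj (p i) (p j) ↔ r i j)

theorem three_le_card_of_le_adjCount {A : Finset V} (hA : A.Nonempty)
    (hD : 2 * A.card ≤ G.adjCount A A) : 3 ≤ A.card := by
  have h1 := adjCount_self_le (G := G) A
  have h2 := hA.card_pos
  by_contra! h
  interval_cases h : A.card <;> omega

theorem not_isConnSet_of_not_adj {S : Finset V} {v u : V} (hv : v ∈ S) (hu : u ∈ S) (hne : u ≠ v)
    (h : ∀ w ∈ S, ¬ G.Adj v w) : ¬ G.IsConnSet S := fun hS => by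
  obtain ⟨w, hw, hvw⟩ := hS.exists_adj hv (Finset.one_lt_card.2 ⟨v, hv, u, hu, hne.symm⟩)
  exact h w hw hvw

variable [DecidableEq V]

/-- A labelling of `A - v` is shifted by one and `v` is given the number `0`. -/
theorem IsLabelling.cons {A : Finset V} {r r' : ℕ → ℕ → Prop} {p : ℕ → V} {v : V} (hv : v ∈ A)
    (hp : G.IsLabelling (A.erase v) r' p)
    (h0 : ∀ j, j + 1 < A.card → (G.Adj v (p j) ↔ r 0 (j + 1)))
    (hr : ∀ i j, i < j → j + 1 < A.card → (r' i j ↔ r (i + 1) (j + 1))) :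
    G.IsLabelling A r (fun i => Nat.casesOn i v p) := by
  have hc : A.card = (A.erase v).card + 1 := (Finset.card_erase_add_one hv).symm
  obtain ⟨h1, h2, h3⟩ := hp
  have hpv : ∀ i, i < (A.erase v).card → p i ≠ v := fun i hi =>
    (Finset.mem_erase.1 (h1 i hi)).1
  refine ⟨?_, ?_, ?_⟩
  · rintro (_ | i) hi
    · exact hv
    · exact Finset.mem_of_mem_erase (h1 i (by omega))
  · rintro (_ | i) hi (_ | j) hj hij
    · rfl
    · exact absurd hij.symm (hpv j (by rw [Set.mem_Iio] at hj; omega))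
    · exact absurd hij (hpv i (by rw [Set.mem_Iio] at hi; omega))
    · rw [Set.mem_Iio] at hi hj
      rw [h2 (Set.mem_Iio.2 (by omega)) (Set.mem_Iio.2 (by omega)) hij]
  · rintro (_ | i) (_ | j) hij hj
    · omega
    · exact h0 j hj
    · omega
    · exact (h3 i j (by omega) (by omega)).trans (hr i j (by omega) hj)

/-- Adjacency of `i < j` in the path `0, …, a - 1` with the further edge `{a - 3, a - 1}`: a path
ending in a triangle. -/
def lollipopRel (a i j : ℕ) : Prop := j = i + 1 ∨ (i + 3 = a ∧ j + 1 = a)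

/-- Adjacency of `i < j` in the path `0, …, n - 1` closed up by the edges `{0, 2}` and
`{n - 3, n - 1}` to have triangles at both ends. -/
def graphLRel (n i j : ℕ) : Prop := j = i + 1 ∨ (i = 0 ∧ j = 2) ∨ (i + 3 = n ∧ j + 1 = n)

/-- Either `v` has two neighbours in the connected set `A`, or it can be removed. -/
theorem IsConnSet.two_adj_or_erase {A : Finset V} (hA : G.IsConnSet A) {v : V} (hv : v ∈ A)
    (h2 : 2 ≤ A.card) : 2 ≤ G.adjCount {v} A ∨
      ∃ w ∈ A.erase v, G.Adj v w ∧ (∀ u ∈ A, G.Adj v u → u = w) ∧ G.IsConnSet (A.erase v) ∧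
        G.adjCount A A = G.adjCount (A.erase v) (A.erase v) + 2 := by
  obtain ⟨w, hw, hvw⟩ := hA.exists_adj hv h2
  have hpos := adjCount_pos (Finset.mem_singleton_self v) hw hvw
  by_cases h : 2 ≤ G.adjCount {v} A
  · exact Or.inl h
  · have hu : ∀ u ∈ A, G.Adj v u → u = w := fun u hu hvu =>
      eq_of_adjCount_le_one (by omega) hw hvw hu hvu
    refine Or.inr ⟨w, Finset.mem_erase.2 ⟨hvw.ne', hw⟩, hvw, hu,
      hA.erase_of_unique_adj hw hvw hu, ?_⟩
    rw [adjCount_self_eq_erase hv]; omega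

theorem IsConnSet.two_mul_le_of_adjCount {A : Finset V} (hA : G.IsConnSet A) {v : V} (hv : v ∈ A)
    (h : 2 ≤ G.adjCount {v} A) : 2 * A.card ≤ (G.connSubsetsAt A v).card + 2 := by
  obtain ⟨x, hx, y, hy, hxy, hvx, hvy⟩ := exists_two_of_adjCount h
  exact hA.two_mul_le_connSubsetsAt hv hx hy hxy hvx hvy

/-- A connected set that contains a cycle has one more connected subset through `v` than vertices:
following the pendant path from `v` one reaches a vertex with two neighbours. -/
theorem IsConnSet.card_lt_connSubsetsAt {A : Finset V} (hA : G.IsConnSet A)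
    (hD : 2 * A.card ≤ G.adjCount A A) {v : V} (hv : v ∈ A) :
    A.card + 1 ≤ (G.connSubsetsAt A v).card := by
  induction hk : A.card using Nat.strong_induction_on generalizing A v with
  | _ k ih =>
    have h3 := three_le_card_of_le_adjCount ⟨v, hv⟩ hD
    rcases hA.two_adj_or_erase hv (by omega) with h | ⟨w, hw, hvw, -, h, hD'⟩
    · have := hA.two_mul_le_of_adjCount hv h
      omega
    · have h4 := Finset.card_erase_of_mem hv
      have h5 := ih (A.erase v).card (by omega) h (by omega) hw rfl
      have h6 := card_connSubsetsAt_erase_lt (G := G) hv hvw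
      omega

/-- Equality in `IsConnSet.card_lt_connSubsetsAt` forces a path from `v` to a triangle. -/
theorem IsConnSet.exists_lollipop_labelling {A : Finset V} (hA : G.IsConnSet A)
    (hD : 2 * A.card ≤ G.adjCount A A) {v : V} (hv : v ∈ A)
    (hR : (G.connSubsetsAt A v).card ≤ A.card + 1) :
    ∃ p, p 0 = v ∧ G.IsLabelling A (lollipopRel A.card) p := by
  induction hk : A.card using Nat.strong_induction_on generalizing A v with
  | _ k ih =>
    subst hk
    have h3 := three_le_card_of_le_adjCount ⟨v, hv⟩ hD
    rcases hA.two_adj_or_erase hv (by omega) with h | ⟨w, hw, hvw, hu, h, hD'⟩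
    · have := hA.two_mul_le_of_adjCount hv h
      have hc : A.card = 3 := by omega
      obtain ⟨x, hx, y, hy, hxy, hvx, hvy⟩ := exists_two_of_adjCount h
      have hAe : {v, x, y} = A := Finset.eq_of_subset_of_card_le
        (by simp [Finset.insert_subset_iff, *])
        (by rw [hc, Finset.card_eq_three.2 ⟨v, x, y, hvx.ne, hvy.ne, hxy, rfl⟩])
      have hadj : G.Adj x y := by
        by_contra hn
        have := adjCount_self_add_card_le (G := G) (A := A) {(x, y)} (by simp [hx, hy, hxy, hn])
        rw [hc, Finset.card_singleton] at this
        omega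
      refine ⟨fun i => if i = 0 then v else if i = 1 then x else y, rfl, ?_, ?_, ?_⟩
      · intro i _
        dsimp only
        split_ifs <;> assumption
      · intro i hi j hj hij
        rw [Set.mem_Iio, hc] at hi hj
        have := hvx.ne
        have := hvy.ne
        dsimp only at hij
        grind
      · intro i j hij hj
        rw [hc] at hj ⊢
        have h1 : (i = 0 ∧ j = 1) ∨ (i = 0 ∧ j = 2) ∨ (i = 1 ∧ j = 2) := by omega
        rcases h1 with ⟨rfl, rfl⟩ | ⟨rfl, rfl⟩ | ⟨rfl, rfl⟩ <;> simp [lollipopRel, *]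
    · have h4 := Finset.card_erase_of_mem hv
      have h6 := card_connSubsetsAt_erase_lt (G := G) hv hvw
      have h3' := three_le_card_of_le_adjCount (G := G) h.1 (by omega : 2 * (A.erase v).card ≤ _)
      obtain ⟨p, hp0, hp⟩ := ih (A.erase v).card (by omega) h (by omega) hw (by omega) rfl
      refine ⟨_, rfl, hp.cons hv (fun j hj => ?_) fun i j hij hj => ?_⟩
      · have hj' : j < (A.erase v).card := by omega
        have : G.Adj v (p j) ↔ j = 0 := by
          constructor
          · intro h
            have := hu (p j) (Finset.mem_of_mem_erase (hp.1 j hj')) h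
            exact hp.2.1 (Set.mem_Iio.2 hj') (Set.mem_Iio.2 (by omega)) (this.trans hp0.symm)
          · rintro rfl
            rwa [hp0]
        rw [this]
        unfold lollipopRel
        omega
      · unfold lollipopRel
        omega

/-- Following the pendant path from `v` ends at a vertex with two neighbours, where the bound
`2 (a - 1)` suffices unless `a = 4`; then the set spans all edges but at most one. -/
theorem IsConnSet.card_add_three_le_connSubsetsAt {A : Finset V} (hA : G.IsConnSet A)
    (hD : 2 * A.card + 2 ≤ G.adjCount A A) {v : V} (hv : v ∈ A) :
    A.card + 3 ≤ (G.connSubsetsAt A v).card := by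
  induction hk : A.card using Nat.strong_induction_on generalizing A v with
  | _ k ih =>
    have h4 : 4 ≤ A.card := by
      have h1 := adjCount_self_le (G := G) A
      have h3 := three_le_card_of_le_adjCount (G := G) ⟨v, hv⟩ (by omega)
      by_contra! h
      interval_cases h : A.card
      omega
    rcases hA.two_adj_or_erase hv (by omega) with h | ⟨w, hw, hvw, -, h, hD'⟩
    · have := hA.two_mul_le_of_adjCount hv h
      by_cases h5 : 5 ≤ A.card
      · omega
      have hc : A.card = 4 := by omega
      by_cases hd : 3 ≤ G.adjCount {v} A
      · obtain ⟨x, hx, y, hy, z, hz, hxy, hxz, hyz, hvx, hvy, hvz⟩ := exists_three_of_adjCount hd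
        have := hA.four_mul_le_connSubsetsAt hv hx hy hz hxy hxz hyz hvx hvy hvz
        omega
      obtain ⟨x, hx, y, hy, hxy, hvx, hvy⟩ := exists_two_of_adjCount h
      obtain ⟨z, hz, hz'⟩ := Finset.exists_of_ssubset (s₁ := {v, x, y}) (s₂ := A)
        ((by simp [Finset.insert_subset_iff, *] : ({v, x, y} : Finset V) ⊆ A).ssubset_of_ne
          (fun h => by
            rw [← h, Finset.card_eq_three.2 ⟨v, x, y, hvx.ne, hvy.ne, hxy, rfl⟩] at hc
            omega))
      simp only [Finset.mem_insert, Finset.mem_singleton, not_or] at hz'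
      obtain ⟨hzv, hzx, hzy⟩ := hz'
      have hvz : ¬ G.Adj v z := fun hvz => by
        rcases eq_or_eq_of_adjCount_le_two (by omega) hx hy hxy hvx hvy hz hvz with h | h
        · exact hzx h
        · exact hzy h
      have hvx' := hvx.ne
      have hvy' := hvy.ne
      -- `{v, z}` is the only pair that is not an edge
      have hadj : ∀ s t, s ∈ A → t ∈ A → s ≠ t → s ≠ v → t ≠ v → G.Adj s t := by
        intro s t hs ht hst hsv htv
        by_contra hn
        have := adjCount_self_add_card_le (G := G) (A := A) {(v, z), (z, v), (s, t)} (by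
          simp only [Finset.mem_insert, Finset.mem_singleton]
          rintro p (rfl | rfl | rfl)
          · exact ⟨hv, hz, Ne.symm hzv, hvz⟩
          · exact ⟨hz, hv, hzv, fun h => hvz h.symm⟩
          · exact ⟨hs, ht, hst, hn⟩)
        rw [hc, Finset.card_eq_three.2 ⟨_, _, _, by simp [hzv], by simp [hsv.symm],
          by simp [htv.symm], rfl⟩] at this
        omega
      have hAe : {v, x} ∪ {v, y, z} = A := Finset.eq_of_subset_of_card_le
        (by simp [Finset.insert_subset_iff, *]) (by
          rw [show ({v, x} ∪ {v, y, z} : Finset V) = {v, x, y, z} by ext; simp; tauto, hc]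
          rw [Finset.card_insert_of_notMem (by simp; tauto),
            Finset.card_eq_three.2 ⟨x, y, z, hxy, Ne.symm hzx, Ne.symm hzy, rfl⟩])
      have hyz := hadj y z hy hz (Ne.symm hzy) (Ne.symm hvy') hzv
      have hxz := hadj x z hx hz (Ne.symm hzx) (Ne.symm hvx') hzv
      have hB : G.IsConnSet {v, y, z} := by
        rw [show ({v, y, z} : Finset V) = {y, v, z} by ext; simp; tauto]
        exact isConnSet_triple hvy.symm hyz
      have h1 := card_mul_card_add_le (G := G) (A := {v, x}) (B := {v, y, z}) (C := A) (v := v)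
        (by ext; simp; grind) hAe {{v, x, z}} (by
          simp only [Finset.mem_singleton]
          rintro S rfl
          refine ⟨by simp [Finset.insert_subset_iff, *], by simp, ?_, fun h => ?_⟩
          · rw [show ({v, x, z} : Finset V) = {x, v, z} by ext; simp; tauto]
            exact isConnSet_triple hvx.symm hxz
          · refine not_isConnSet_of_not_adj (v := v) (u := z) (by simp) (by simp) hzv ?_ h.2
            simp only [Finset.mem_inter, Finset.mem_insert, Finset.mem_singleton]
            rintro w ⟨h1, h2⟩ h3
            have := h3.ne
            grind)
      have h2 := (isConnSet_pair hvx).card_le_connSubsetsAt (v := v) (by simp)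
      have h3 := hB.card_le_connSubsetsAt (v := v) (by simp)
      rw [Finset.card_pair hvx'] at h2
      rw [Finset.card_eq_three.2 ⟨v, y, z, hvy', Ne.symm hzv, Ne.symm hzy, rfl⟩] at h3
      rw [Finset.card_singleton] at h1
      have := Nat.mul_le_mul h2 h3
      omega
    · have h4 := Finset.card_erase_of_mem hv
      have h5 := ih (A.erase v).card (by omega) h (by omega) hw rfl
      have h6 := card_connSubsetsAt_erase_lt (G := G) hv hvw
      omega

/-- A connected set with `a` vertices that contains a cycle has at least `a (a + 1) / 2 + a - 2`
connected subsets. -/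
theorem IsConnSet.le_two_connSubsets_of_adjCount {A : Finset V} (hA : G.IsConnSet A)
    (hD : 2 * A.card ≤ G.adjCount A A) :
    A.card * A.card + 3 * A.card ≤ 2 * (G.connSubsets A).card + 4 := by
  induction hk : A.card using Nat.strong_induction_on generalizing A with
  | _ k ih =>
    have h3 := three_le_card_of_le_adjCount hA.1 hD
    obtain ⟨v, hv⟩ := hA.1
    obtain ⟨u, hu, -, h⟩ := hA.exists_ne_erase hv (by omega)
    have h4 := Finset.card_erase_of_mem hu
    have h5 := adjCount_self_eq_erase (G := G) hu
    rw [card_connSubsets_eq (v := u)]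
    obtain ⟨m, rfl⟩ : ∃ m, k = m + 1 := ⟨k - 1, by omega⟩
    rw [hk, Nat.add_sub_cancel] at h4
    by_cases h6 : 2 * (A.erase u).card ≤ G.adjCount (A.erase u) (A.erase u)
    · have h7 := ih (A.erase u).card (by omega) h h6 rfl
      have h8 := hA.card_lt_connSubsetsAt hD hu
      rw [h4] at h7
      nlinarith
    · have h7 := h.card_mul_le_two_connSubsets
      have h8 := hA.two_mul_le_of_adjCount hu (by omega)
      rw [h4] at h7
      nlinarith

theorem IsConnSet.fourteen_le_connSubsets {A : Finset V} (hA : G.IsConnSet A)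
    (hc : A.card = 4) (hD : 10 ≤ G.adjCount A A) : 14 ≤ (G.connSubsets A).card := by
  obtain ⟨v, hv⟩ := hA.1
  obtain ⟨u, hu, -, h⟩ := hA.exists_ne_erase hv (by omega)
  have h4 := Finset.card_erase_of_mem hu
  have h5 := adjCount_self_eq_erase (G := G) hu
  rw [card_connSubsets_eq (v := u)]
  rw [hc] at h4
  by_cases h6 : 2 * (A.erase u).card ≤ G.adjCount (A.erase u) (A.erase u)
  · have h7 := h.le_two_connSubsets_of_adjCount h6
    have h8 := hA.card_add_three_le_connSubsetsAt (by omega) hu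
    rw [h4] at h7
    omega
  · have h7 := h.card_mul_le_two_connSubsets
    obtain ⟨x, hx, y, hy, z, hz, hxy, hxz, hyz, hvx, hvy, hvz⟩ :=
      exists_three_of_adjCount (G := G) (v := u) (B := A) (by omega)
    have := hA.four_mul_le_connSubsetsAt hu hx hy hz hxy hxz hyz hvx hvy hvz
    rw [h4] at h7
    omega

end SimpleGraph

/-! ### Bicyclic graphs with at least six vertices -/

namespace SimpleGraph

variable {V : Type*} {G : SimpleGraph V} [DecidableEq V]

/-- The situation of a vertex `v` of degree two in `C` that is not a cut vertex: `C` is the union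
of connected sets `A` and `B` that share only `v`, the neighbours of `v` in `C` are `x` in `A` and
`y` in `B`, and `C` spans as many edges as a bicyclic graph on `C`. -/
structure IsSplitAt (G : SimpleGraph V) (C A B : Finset V) (v x y : V) : Prop where
  connA : G.IsConnSet A
  connB : G.IsConnSet B
  inter : A ∩ B = {v}
  union : A ∪ B = C
  memx : x ∈ A
  memy : y ∈ B
  adjx : G.Adj v x
  adjy : G.Adj v y
  uniq : ∀ u ∈ C, G.Adj v u → u = x ∨ u = y
  conn_erase : G.IsConnSet (C.erase v)
  count : G.adjCount C C = 2 * C.card + 2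

namespace IsSplitAt

variable {C A B : Finset V} {v x y : V}

theorem symm (h : G.IsSplitAt C A B v x y) : G.IsSplitAt C B A v y x where
  connA := h.connB
  connB := h.connA
  inter := by rw [Finset.inter_comm, h.inter]
  union := by rw [Finset.union_comm, h.union]
  memx := h.memy
  memy := h.memx
  adjx := h.adjy
  adjy := h.adjx
  uniq u hu hvu := (h.uniq u hu hvu).symm
  conn_erase := h.conn_erase
  count := h.count

theorem mem_left (h : G.IsSplitAt C A B v x y) : v ∈ A := by
  have : v ∈ A ∩ B := by rw [h.inter]; simp
  exact (Finset.mem_inter.1 this).1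

theorem mem_right (h : G.IsSplitAt C A B v x y) : v ∈ B := h.symm.mem_left

theorem eq_of_mem (h : G.IsSplitAt C A B v x y) {u : V} (hA : u ∈ A) (hB : u ∈ B) : u = v := by
  have : u ∈ A ∩ B := Finset.mem_inter.2 ⟨hA, hB⟩
  rw [h.inter] at this
  exact Finset.mem_singleton.1 this

theorem left_subset (h : G.IsSplitAt C A B v x y) : A ⊆ C := h.union ▸ Finset.subset_union_left

theorem right_subset (h : G.IsSplitAt C A B v x y) : B ⊆ C := h.symm.left_subset

theorem eq_of_adj_left (h : G.IsSplitAt C A B v x y) {u : V} (hu : u ∈ A) (hvu : G.Adj v u) :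
    u = x := by
  rcases h.uniq u (h.left_subset hu) hvu with hx | hy
  · exact hx
  · exact absurd (h.eq_of_mem hu (hy ▸ h.memy)) hvu.ne'

theorem eq_of_adj_right (h : G.IsSplitAt C A B v x y) {u : V} (hu : u ∈ B) (hvu : G.Adj v u) :
    u = y := h.symm.eq_of_adj_left hu hvu

theorem card_add_card (h : G.IsSplitAt C A B v x y) : A.card + B.card = C.card + 1 :=
  card_add_card_of_inter_eq_singleton h.inter h.union

theorem adjCount_left (h : G.IsSplitAt C A B v x y) : G.adjCount {v} A = 1 := by
  have h1 := adjCount_pos (Finset.mem_singleton_self v) h.memx h.adjx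
  by_contra hne
  obtain ⟨a, ha, b, hb, hab, hva, hvb⟩ := exists_two_of_adjCount (G := G) (v := v) (B := A)
    (by omega)
  exact hab ((h.eq_of_adj_left ha hva).trans (h.eq_of_adj_left hb hvb).symm)

theorem adjCount_left_erase (h : G.IsSplitAt C A B v x y) :
    G.adjCount A A = G.adjCount (A.erase v) (A.erase v) + 2 := by
  rw [adjCount_self_eq_erase h.mem_left, h.adjCount_left]

theorem disjoint (h : G.IsSplitAt C A B v x y) : Disjoint (A.erase v) (B.erase v) :=
  Finset.disjoint_left.2 fun _ ha hb =>
    (Finset.mem_erase.1 ha).1 (h.eq_of_mem (Finset.mem_of_mem_erase ha)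
      (Finset.mem_of_mem_erase hb))

/-- The edges of `C` are those of `A`, those of `B` and those between `A - v` and `B - v`. -/
theorem adjCount_add (h : G.IsSplitAt C A B v x y) :
    G.adjCount A A + G.adjCount B B + 2 * G.adjCount (A.erase v) (B.erase v) =
      2 * A.card + 2 * B.card := by
  have h1 := adjCount_union_self (G := G) h.disjoint
  rw [← Finset.erase_union_distrib, h.union] at h1
  have h2 := adjCount_self_eq_erase (G := G) (h.left_subset h.mem_left)
  have h3 : G.adjCount {v} C = 2 := by
    have h4 := adjCount_union_right (G := G) (A := A) (B := B.erase v)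
      (Finset.disjoint_left.2 fun a ha hb => (Finset.mem_erase.1 hb).1
        (h.eq_of_mem ha (Finset.mem_of_mem_erase hb))) {v}
    have h5 := adjCount_union_right (G := G) (A := {v}) (B := B.erase v) (by simp) {v}
    rw [← Finset.insert_eq, Finset.insert_erase h.mem_right, adjCount_singleton_self,
      h.symm.adjCount_left] at h5
    have h6 : A ∪ B.erase v = C := by
      rw [← h.union]
      ext u
      simp only [Finset.mem_union, Finset.mem_erase]
      have := h.mem_left
      grind
    rw [h6, h.adjCount_left] at h4
    omega
  have := h.count
  have := h.card_add_card
  have := h.adjCount_left_erase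
  have := h.symm.adjCount_left_erase
  omega

/-- The edge from `p` to `B` makes `insert p B` connected, while its trace `{v, p}` on `A` is
disconnected. -/
theorem insert_mem (h : G.IsSplitAt C A B v x y) {p q : V} (hp : p ∈ A.erase v)
    (hq : q ∈ B.erase v) (hpq : G.Adj p q) (hpx : p ≠ x) :
    insert p B ⊆ C ∧ v ∈ insert p B ∧ G.IsConnSet (insert p B) ∧
      ¬ (G.IsConnSet (insert p B ∩ A) ∧ G.IsConnSet (insert p B ∩ B)) := by
  rw [Finset.mem_erase] at hp hq
  refine ⟨Finset.insert_subset (h.left_subset hp.2) h.right_subset,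
    Finset.mem_insert_of_mem h.mem_right, h.connB.insert_adj hq.2 hpq.symm, fun hc => ?_⟩
  refine not_isConnSet_of_not_adj (v := v) (u := p) ?_ ?_ hp.1 ?_ hc.1
  · exact Finset.mem_inter.2 ⟨Finset.mem_insert_of_mem h.mem_right, h.mem_left⟩
  · exact Finset.mem_inter.2 ⟨Finset.mem_insert_self _ _, hp.2⟩
  · intro w hw hvw
    rw [Finset.mem_inter, Finset.mem_insert] at hw
    obtain ⟨rfl | hwB, hwA⟩ := hw
    · exact hpx (h.eq_of_adj_left hwA hvw)
    · exact hvw.ne' (h.eq_of_mem hwA hwB)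

/-- The two edges beyond a spanning tree either lie on one side, and make a factor of the product
bound larger, or one of them gives a connected set with a disconnected trace. -/
theorem two_mul_card_lt (h : G.IsSplitAt C A B v x y) (hA : 3 ≤ A.card) (hB : 3 ≤ B.card)
    (hC : 6 ≤ C.card) : 2 * C.card < (G.connSubsetsAt C v).card := by
  have h1 := h.card_add_card
  have hA1 := h.connA.card_le_connSubsetsAt h.mem_left
  have hB1 := h.connB.card_le_connSubsetsAt h.mem_right
  obtain ⟨a, ha⟩ : ∃ a, A.card = a + 3 := ⟨A.card - 3, by omega⟩
  obtain ⟨b, hb⟩ : ∃ b, B.card = b + 3 := ⟨B.card - 3, by omega⟩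
  by_cases hDA : 2 * A.card ≤ G.adjCount A A
  · have h2 := h.connA.card_lt_connSubsetsAt hDA h.mem_left
    have h3 := card_mul_card_le (G := G) h.inter h.union
    have h4 := Nat.mul_le_mul h2 hB1
    rw [ha, hb] at h4
    nlinarith
  by_cases hDB : 2 * B.card ≤ G.adjCount B B
  · have h2 := h.connB.card_lt_connSubsetsAt hDB h.mem_right
    have h3 := card_mul_card_le (G := G) h.inter h.union
    have h4 := Nat.mul_le_mul hA1 h2
    rw [ha, hb] at h4
    nlinarith
  have hAeven := even_adjCount_self (G := G) A
  have hBeven := even_adjCount_self (G := G) B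
  have hadd := h.adjCount_add
  obtain ⟨p, hp, q, hq, hpq, hne⟩ := exists_adj_ne_of_two_le_adjCount (G := G)
    (X := A.erase v) (Y := B.erase v) (x := x) (y := y) (by grind)
    (Finset.mem_erase.2 ⟨h.adjx.ne', h.memx⟩)
  have key : (G.connSubsetsAt A v).card * (G.connSubsetsAt B v).card + 1 ≤
      (G.connSubsetsAt C v).card := by
    rcases hne with hpx | hqy
    · refine card_mul_card_add_le h.inter h.union {insert p B} fun S hS => ?_
      rw [Finset.mem_singleton.1 hS]
      exact h.insert_mem hp hq hpq hpx
    · rw [mul_comm]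
      refine card_mul_card_add_le h.symm.inter h.symm.union {insert q A} fun S hS => ?_
      rw [Finset.mem_singleton.1 hS]
      exact h.symm.insert_mem hq hp hpq.symm hqy
  have h4 := Nat.mul_le_mul hA1 hB1
  rw [ha, hb] at h4
  nlinarith

/-- If `A = {v, x}`, every connected set through `x` that uses no further vertex than those of
`B - v - y` gives, with `v`, a connected set with a disconnected trace on `B`. -/
theorem two_mul_add_card_le (h : G.IsSplitAt C A B v x y) (hA : A = {v, x})
    (T : Finset (Finset V)) (hT : ∀ S ∈ T, S ⊆ (B.erase v).erase y ∧ S.Nonempty ∧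
      G.IsConnSet (insert x S)) :
    2 * (G.connSubsetsAt B v).card + T.card ≤ (G.connSubsetsAt C v).card := by
  have hxB : x ∉ B := fun hx => h.adjx.ne' (h.eq_of_mem h.memx hx)
  have h2 := h.connA.card_le_connSubsetsAt h.mem_left
  rw [hA, Finset.card_pair h.adjx.ne, ← hA] at h2
  have hsub : ∀ S ∈ T, S ⊆ B ∧ v ∉ S ∧ y ∉ S := by
    intro S hS
    have := (hT S hS).1
    rw [Finset.subset_erase, Finset.subset_erase] at this
    exact ⟨this.1.1, this.1.2, this.2⟩
  have hinj : Set.InjOn (fun S : Finset V => insert v (insert x S)) T := by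
    intro S hS S' hS' heq
    obtain ⟨h1, h2, -⟩ := hsub S hS
    obtain ⟨h3, h4, -⟩ := hsub S' hS'
    have e1 : ∀ R : Finset V, R ⊆ B → v ∉ R → ((insert v (insert x R)).erase v).erase x = R := by
      intro R hRB hvR
      rw [Finset.erase_insert, Finset.erase_insert fun hx => hxB (hRB hx)]
      simp [hvR, h.adjx.ne]
    simp only at heq
    rw [← e1 S h1 h2, heq, e1 S' h3 h4]
  have h3 := card_mul_card_add_le (G := G) h.inter h.union
    (T.image fun S : Finset V => insert v (insert x S)) (by
      intro S hS
      obtain ⟨S, hST, rfl⟩ := Finset.mem_image.1 hS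
      obtain ⟨h1, h2, h3⟩ := hsub S hST
      obtain ⟨-, ⟨s, hs⟩, hconn⟩ := hT S hST
      refine ⟨?_, Finset.mem_insert_self _ _,
        hconn.insert_adj (Finset.mem_insert_self x S) h.adjx.symm, fun hc => ?_⟩
      · exact Finset.insert_subset (h.left_subset h.mem_left)
          (Finset.insert_subset (h.left_subset h.memx) (h1.trans h.right_subset))
      · refine not_isConnSet_of_not_adj (v := v) (u := s) ?_ ?_ (fun he => h2 (he ▸ hs)) ?_ hc.2
        · exact Finset.mem_inter.2 ⟨Finset.mem_insert_self _ _, h.mem_right⟩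
        · exact Finset.mem_inter.2
            ⟨Finset.mem_insert_of_mem (Finset.mem_insert_of_mem hs), h1 hs⟩
        · intro w hw hvw
          rw [Finset.mem_inter] at hw
          have hwy := h.eq_of_adj_right hw.2 hvw
          have hwv := hvw.ne'
          have hwx : w ≠ x := fun he => hxB (he ▸ hw.2)
          simp only [Finset.mem_insert, hwv, hwx, false_or] at hw
          exact h3 (hwy ▸ hw.1))
  rw [Finset.card_image_of_injOn hinj] at h3
  have := Nat.mul_le_mul_right (G.connSubsetsAt B v).card h2
  omega

/-- The case `A = {v, x}`. If `B` contains a cycle, equality makes `B` a path from `v` to a triangle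
and `y` the only further neighbour of `x`. Otherwise `x` has two neighbours in `B - v`, and they
yield enough connected sets with a disconnected trace on `B`. -/
theorem two_mul_card_le_of_eq_pair (h : G.IsSplitAt C A B v x y) (hA : A = {v, x})
    (hC : 6 ≤ C.card) : 2 * C.card ≤ (G.connSubsetsAt C v).card ∧
      ((G.connSubsetsAt C v).card = 2 * C.card →
        ∃ p, G.IsLabelling C (graphLRel C.card) p) := by
  have hcard := h.card_add_card
  have hA2 : A.card = 2 := by rw [hA, Finset.card_pair h.adjx.ne]
  have hxB : x ∉ B := fun hx => h.adjx.ne' (h.eq_of_mem h.memx hx)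
  have hAe : A.erase v = {x} := by rw [hA, Finset.erase_insert (by simp [h.adjx.ne])]
  have hDA : G.adjCount A A = 2 := by
    rw [h.adjCount_left_erase, hAe, adjCount_singleton_self]
  have hadd := h.adjCount_add
  rw [hDA, hAe, hA2] at hadd
  have hCx : C.erase x = B := by
    rw [← h.union, hA]
    ext u
    simp only [Finset.mem_erase, Finset.mem_union, Finset.mem_insert, Finset.mem_singleton]
    have := h.mem_right
    grind
  have hBn := h.connB.le_adjCount
  have hBeven := even_adjCount_self (G := G) B
  have hyY : y ∈ B.erase v := Finset.mem_erase.2 ⟨h.adjy.ne', h.memy⟩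
  -- `x` has a neighbour other than `v`
  have hpos : 0 < G.adjCount {x} (B.erase v) := by
    have hxe : x ∈ C.erase v := Finset.mem_erase.2 ⟨h.adjx.ne', h.left_subset h.memx⟩
    obtain ⟨w, hw, hxw⟩ := h.conn_erase.exists_adj hxe (by
      rw [Finset.card_erase_of_mem (h.left_subset h.mem_left)]; omega)
    refine adjCount_pos (Finset.mem_singleton_self x) (?_ : w ∈ B.erase v) hxw
    rw [Finset.mem_erase] at hw ⊢
    exact ⟨hw.1, hCx ▸ Finset.mem_erase.2 ⟨hxw.ne', hw.2⟩⟩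
  by_cases hDB : 2 * B.card ≤ G.adjCount B B
  · have hR := h.connB.card_lt_connSubsetsAt hDB h.mem_right
    obtain ⟨x', hx', q, hq, hxq⟩ := exists_adj_of_adjCount_pos hpos
    obtain rfl := Finset.mem_singleton.1 hx'
    by_cases hqy : q = y
    · subst hqy
      have h0 := h.two_mul_add_card_le hA ∅ (by simp)
      rw [Finset.card_empty] at h0
      refine ⟨by omega, fun heq => ?_⟩
      obtain ⟨p, hp0, hp⟩ := h.connB.exists_lollipop_labelling hDB h.mem_right (by omega)
      have hp1 : p 1 = q := by
        refine h.eq_of_adj_right (hp.1 1 (by omega)) ?_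
        rw [← hp0]
        exact (hp.2.2 0 1 (by omega) (by omega)).2 (Or.inl rfl)
      rw [← hCx] at hp
      have hxC := h.left_subset h.memx
      have hce := Finset.card_erase_of_mem hxC
      refine ⟨_, hp.cons hxC (fun j hj => ?_) fun i j hij hj => ?_⟩
      · have hjC : j < (C.erase x').card := by omega
        have : G.Adj x' (p j) ↔ j = 0 ∨ j = 1 := by
          constructor
          · intro hadj
            by_cases hjv : p j = v
            · exact Or.inl (hp.2.1 (Set.mem_Iio.2 hjC) (Set.mem_Iio.2 (by omega))
                (hjv.trans hp0.symm))
            · refine Or.inr (hp.2.1 (Set.mem_Iio.2 hjC) (Set.mem_Iio.2 (by omega)) ?_)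
              rw [hp1]
              refine eq_of_adjCount_le_one (v := x') (B := B.erase v) (by grind) hq hxq ?_ hadj
              exact Finset.mem_erase.2 ⟨hjv, hCx ▸ hp.1 j hjC⟩
          · rintro (rfl | rfl)
            · rw [hp0]; exact h.adjx.symm
            · rwa [hp1]
        rw [this]
        unfold graphLRel
        omega
      · unfold graphLRel lollipopRel
        omega
    · have h1 := h.two_mul_add_card_le hA {{q}} (by
        simp only [Finset.mem_singleton]
        rintro S rfl
        exact ⟨by simpa using ⟨hqy, Finset.mem_erase.1 hq⟩, by simp, isConnSet_pair hxq⟩)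
      rw [Finset.card_singleton] at h1
      omega
  · have hb := h.connB.card_le_connSubsetsAt h.mem_right
    suffices 2 * C.card < (G.connSubsetsAt C v).card by omega
    obtain ⟨q₁, hq₁, q₂, hq₂, hne, hx₁, hx₂⟩ := exists_two_of_adjCount (G := G) (v := x)
      (B := B.erase v) (by grind)
    -- if `y` is adjacent to `x`, either `y` branches in `B - v`, or `B - v - y` is connected
    -- and has three connected sets through the other neighbour `q`
    have hmain : ∀ q ∈ B.erase v, q ≠ y → G.Adj x q → G.Adj x y →
        2 * C.card < (G.connSubsetsAt C v).card := by
      intro q hq hqy hxq hxy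
      have hYconn := h.connB.erase_of_unique_adj h.memy h.adjy
        fun u hu hvu => h.eq_of_adj_right hu hvu
      have hYcard := Finset.card_erase_of_mem h.mem_right
      rcases hYconn.two_adj_or_erase hyY (by omega) with h2 | ⟨w, hw, hyw, -, hZ, -⟩
      · have h3 := hYconn.two_mul_le_of_adjCount hyY h2
        have h4 := card_connSubsetsAt_erase_lt (G := G) h.mem_right h.adjy
        have h5 := h.two_mul_add_card_le hA ∅ (by simp)
        omega
      · have hqZ := Finset.mem_erase.2 ⟨hqy, hq⟩
        have h3 := hZ.card_le_connSubsetsAt hqZ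
        rw [Finset.card_erase_of_mem hyY] at h3
        have h4 := h.two_mul_add_card_le hA (G.connSubsetsAt ((B.erase v).erase y) q) (by
          intro S hS
          rw [mem_connSubsetsAt] at hS
          exact ⟨hS.1, ⟨q, hS.2.1⟩, hS.2.2.insert_adj hS.2.1 hxq.symm⟩)
        omega
    by_cases h1 : q₁ = y
    · exact hmain q₂ hq₂ (fun he => hne (h1.trans he.symm)) hx₂ (h1 ▸ hx₁)
    by_cases h2 : q₂ = y
    · exact hmain q₁ hq₁ h1 hx₁ (h2 ▸ hx₂)
    have h3 := h.two_mul_add_card_le hA {{q₁}, {q₂}, {q₁, q₂}} (by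
      simp only [Finset.mem_insert, Finset.mem_singleton]
      rw [Finset.mem_erase] at hq₁ hq₂
      rintro S (rfl | rfl | rfl)
      · exact ⟨by simp [*], by simp, isConnSet_pair hx₁⟩
      · exact ⟨by simp [*], by simp, isConnSet_pair hx₂⟩
      · exact ⟨by simp [Finset.insert_subset_iff, *], by simp, isConnSet_triple hx₁ hx₂⟩)
    have hc3 : ({{q₁}, {q₂}, {q₁, q₂}} : Finset (Finset V)).card = 3 := by
      refine Finset.card_eq_three.2 ⟨{q₁}, {q₂}, {q₁, q₂}, ?_, fun he => hne ?_, fun he => hne ?_,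
        rfl⟩
      · rwa [Ne, Finset.singleton_inj]
      · have : q₂ ∈ ({q₁} : Finset V) := he ▸ by simp
        exact (Finset.mem_singleton.1 this).symm
      · have : q₁ ∈ ({q₂} : Finset V) := he ▸ by simp
        exact Finset.mem_singleton.1 this
    omega

theorem two_mul_card_le (h : G.IsSplitAt C A B v x y)
    (hC : 6 ≤ C.card) : 2 * C.card ≤ (G.connSubsetsAt C v).card ∧
      ((G.connSubsetsAt C v).card = 2 * C.card →
        ∃ p, G.IsLabelling C (graphLRel C.card) p) := by
  -- a side with at most two vertices consists of `v` and its neighbour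
  have key : ∀ {A B : Finset V} {x y : V}, G.IsSplitAt C A B v x y → A.card ≤ 2 → A = {v, x} := by
    intro A B x y h hA
    refine (Finset.eq_of_subset_of_card_le ?_ ?_).symm
    · exact Finset.insert_subset h.mem_left (Finset.singleton_subset_iff.2 h.memx)
    · rwa [Finset.card_pair h.adjx.ne]
  by_cases hA : A.card ≤ 2
  · exact h.two_mul_card_le_of_eq_pair (key h hA) hC
  by_cases hB : B.card ≤ 2
  · exact h.symm.two_mul_card_le_of_eq_pair (key h.symm hB) hC
  have := h.two_mul_card_lt (by omega) (by omega) hC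
  exact ⟨by omega, fun h => by omega⟩

end IsSplitAt

/-- The induction step: `v` is any vertex that is not a cut vertex. -/
theorem IsConnSet.bicyclic_step {C : Finset V} (hC : G.IsConnSet C)
    (hD : G.adjCount C C = 2 * C.card + 2) (h6 : 6 ≤ C.card)
    (ih : ∀ S ⊆ C, G.IsConnSet S → S.card + 1 = C.card → G.adjCount S S = 2 * S.card + 2 →
      (S.card + 6) * (S.card - 1) ≤ 2 * (G.connSubsets S).card) :
    (C.card + 6) * (C.card - 1) ≤ 2 * (G.connSubsets C).card ∧
      (2 * (G.connSubsets C).card = (C.card + 6) * (C.card - 1) →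
        ∃ p, G.IsLabelling C (graphLRel C.card) p) := by
  obtain ⟨r, hr⟩ := hC.1
  obtain ⟨v, hv, -, hconn⟩ := hC.exists_ne_erase hr (by omega)
  have hce := Finset.card_erase_of_mem hv
  have h1 := adjCount_self_eq_erase (G := G) hv
  have h2 := hconn.le_adjCount
  obtain ⟨w, hw, hvw⟩ := hC.exists_adj hv (by omega)
  have h3 := adjCount_pos (Finset.mem_singleton_self v) hw hvw
  rw [card_connSubsets_eq (v := v)]
  obtain ⟨m, hm⟩ : ∃ m, C.card = m + 6 := ⟨C.card - 6, by omega⟩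
  rw [hm] at hce
  have e1 : m + 6 - 1 = m + 5 := by omega
  rw [e1] at hce
  obtain hd | hd | hd : G.adjCount {v} C = 1 ∨ G.adjCount {v} C = 2 ∨ G.adjCount {v} C = 3 := by
    omega
  -- `v` is pendant, and the induction hypothesis applies to `C - v`
  · have h4 := ih (C.erase v) (Finset.erase_subset _ _) hconn (by omega) (by omega)
    have h5 := hC.card_add_three_le_connSubsetsAt (by omega) hv
    rw [hce, show m + 5 - 1 = m + 4 by omega] at h4
    rw [hm, e1]
    constructor
    · nlinarith
    · intro h
      nlinarith
  -- `C - v` still contains a cycle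
  · obtain ⟨x, hx, y, hy, hxy, hvx, hvy⟩ := exists_two_of_adjCount hd.ge
    obtain ⟨A, B, hA, hB, hcA, hcB, hAB, hAC⟩ := hC.exists_extend (isConnSet_pair hvx)
      (isConnSet_pair hvy) (v := v) (by simp [Finset.insert_subset_iff, *])
      (by simp [Finset.insert_subset_iff, *])
      (by ext z; simp only [Finset.mem_inter, Finset.mem_insert, Finset.mem_singleton]; grind)
    have hs : G.IsSplitAt C A B v x y := ⟨hcA, hcB, hAB, hAC, hA (by simp), hB (by simp), hvx, hvy,
      fun u hu hvu => eq_or_eq_of_adjCount_le_two hd.le hx hy hxy hvx hvy hu hvu, hconn, hD⟩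
    obtain ⟨h4, h5⟩ := hs.two_mul_card_le h6
    have h7 := hconn.le_two_connSubsets_of_adjCount (by omega)
    rw [hce] at h7
    constructor
    · rw [hm, e1]
      nlinarith
    · intro h
      refine h5 ?_
      rw [hm, e1] at h
      nlinarith
  -- `C - v` is a tree
  · obtain ⟨x, hx, y, hy, z, hz, hxy, hxz, hyz, hvx, hvy, hvz⟩ := exists_three_of_adjCount hd.ge
    have h4 := hC.four_mul_le_connSubsetsAt hv hx hy hz hxy hxz hyz hvx hvy hvz
    have h5 := hconn.card_mul_le_two_connSubsets
    rw [hce] at h5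
    rw [hm, e1]
    constructor
    · nlinarith
    · intro h
      nlinarith

end SimpleGraph

/-! ### Bicyclic graphs with five vertices -/

namespace SimpleGraph

variable {V : Type*} {G : SimpleGraph V}

/-- Adjacency of `i < j` in `graphA 5`. -/
def graphARel (i j : ℕ) : Prop := j = i + 1 ∨ (i = 0 ∧ j = 2) ∨ (i = 1 ∧ j = 3)

theorem exists_isLabelling_of_fin {A : Finset V} {r : ℕ → ℕ → Prop} {m : ℕ} (hm : A.card = m)
    [NeZero m] (f : Fin m → V) (hf : ∀ i, f i ∈ A) (hinj : Function.Injective f)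
    (hr : ∀ i j : Fin m, i < j → (G.Adj (f i) (f j) ↔ r i j)) : ∃ p, G.IsLabelling A r p := by
  subst hm
  refine ⟨fun i => f (Fin.ofNat _ i), fun i _ => hf _, fun i hi j hj hij => ?_,
    fun i j hij hj => ?_⟩
  · have := congrArg Fin.val (hinj hij)
    rwa [Fin.val_ofNat, Fin.val_ofNat, Nat.mod_eq_of_lt hi, Nat.mod_eq_of_lt hj] at this
  · have hi' : i % A.card = i := Nat.mod_eq_of_lt (hij.trans hj)
    have hj' : j % A.card = j := Nat.mod_eq_of_lt hj
    have := hr (Fin.ofNat _ i) (Fin.ofNat _ j)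
      (by rw [Fin.lt_def, Fin.val_ofNat, Fin.val_ofNat, hi', hj']; exact hij)
    rwa [Fin.val_ofNat, Fin.val_ofNat, hi', hj'] at this

theorem adjCount_eq_sum (A B : Finset V) : G.adjCount A B = ∑ a ∈ A, G.adjCount {a} B := by
  simp [adjCount]

theorem exists_not_adj_of_adjCount_lt {v : V} {B : Finset V} (h : G.adjCount {v} B < B.card) :
    ∃ w ∈ B, ¬ G.Adj v w := by
  classical
  rw [adjCount_singleton_left] at h
  by_contra! hall
  rw [Finset.filter_true_of_mem hall] at h
  exact lt_irrefl _ h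

variable [DecidableEq V]

theorem adjCount_erase_of_not_adj {v w : V} (B : Finset V) (h : ¬ G.Adj v w) :
    G.adjCount {v} (B.erase w) = G.adjCount {v} B := by
  classical
  rw [adjCount_singleton_left, adjCount_singleton_left, Finset.filter_erase,
    Finset.erase_eq_of_notMem]
  simp [h]

theorem adjCount_erase_of_adj {v w : V} {B : Finset V} (hw : w ∈ B) (h : G.Adj v w) :
    G.adjCount {v} (B.erase w) + 1 = G.adjCount {v} B := by
  classical
  rw [adjCount_singleton_left, adjCount_singleton_left, Finset.filter_erase,
    Finset.card_erase_add_one]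
  exact Finset.mem_filter.2 ⟨hw, h⟩

/-- If there is a pendant vertex, deleting it leaves four vertices with all
edges but one, and the missing edge has to end at the neighbour of the pendant vertex. -/
theorem bicyclic_five_of_pendant {C : Finset V} (h5 : C.card = 5)
    (hD : G.adjCount C C = 12) {v w : V} (hv : v ∈ C) (hw : w ∈ C.erase v) (hvw : G.Adj v w)
    (hu : ∀ u ∈ C, G.Adj v u → u = w) (hK : G.IsConnSet (C.erase v))
    (hDK : G.adjCount C C = G.adjCount (C.erase v) (C.erase v) + 2) :
    22 ≤ (G.connSubsets C).card ∧
      ((G.connSubsets C).card = 22 → ∃ p, G.IsLabelling C graphARel p) := by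
  have hK4 := Finset.card_erase_of_mem hv
  rw [h5] at hK4
  have h1 := hK.fourteen_le_connSubsets hK4 (by omega)
  have h2 := card_connSubsetsAt_erase_lt (G := G) hv hvw
  have h3 := hK.card_add_three_le_connSubsetsAt (by omega) hw
  rw [card_connSubsets_eq (v := v)]
  refine ⟨by omega, fun heq => ?_⟩
  have hdw : G.adjCount {w} (C.erase v) ≤ 2 := by
    by_contra! hd
    obtain ⟨x, hx, y, hy, z, hz, hxy, hxz, hyz, hwx, hwy, hwz⟩ := exists_three_of_adjCount hd
    have := hK.four_mul_le_connSubsetsAt hw hx hy hz hxy hxz hyz hwx hwy hwz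
    omega
  have hKw := Finset.card_erase_of_mem hw
  obtain ⟨z, hz, hwz⟩ := exists_not_adj_of_adjCount_lt (G := G) (v := w)
    (B := (C.erase v).erase w) (by
      rw [adjCount_erase_of_not_adj _ (G.loopless.irrefl w)]; omega)
  have hKz := Finset.card_erase_of_mem hz
  obtain ⟨p, q, hpq, hpqe⟩ := Finset.card_eq_two.1
    (show (((C.erase v).erase w).erase z).card = 2 by omega)
  have hp : p ∈ ((C.erase v).erase w).erase z := by simp [hpqe]
  have hq : q ∈ ((C.erase v).erase w).erase z := by simp [hpqe]
  simp only [Finset.mem_erase] at hp hq hz hw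
  -- `{w, z}` is the only pair in `C - v` that is not an edge
  have hadj : ∀ s t, s ∈ C.erase v → t ∈ C.erase v → s ≠ t → (s ≠ w ∨ t ≠ z) →
      (s ≠ z ∨ t ≠ w) → G.Adj s t := by
    intro s t hs ht hst h1 h2
    by_contra hn
    have := adjCount_self_add_card_le (G := G) (A := C.erase v) {(w, z), (z, w), (s, t)} (by
      simp only [Finset.mem_insert, Finset.mem_singleton]
      rintro p (rfl | rfl | rfl)
      · exact ⟨by simp [hw], by simp [hz], Ne.symm hz.1, hwz⟩
      · exact ⟨by simp [hz], by simp [hw], hz.1, fun h => hwz h.symm⟩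
      · exact ⟨hs, ht, hst, hn⟩)
    rw [hK4, Finset.card_eq_three.2 ⟨(w, z), (z, w), (s, t), by simp; grind, by simp; grind,
      by simp; grind, rfl⟩] at this
    omega
  have hvn : ∀ u ∈ C, u ≠ w → ¬ G.Adj v u := fun u huC huw h => huw (hu u huC h)
  have a1 : G.Adj z p := hadj z p (by simp [hz]) (by simp [hp]) (by grind) (by grind) (by grind)
  have a2 : G.Adj z q := hadj z q (by simp [hz]) (by simp [hq]) (by grind) (by grind) (by grind)
  have a3 : G.Adj p q := hadj p q (by simp [hp]) (by simp [hq]) (by grind) (by grind) (by grind)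
  have a4 : G.Adj p w := hadj p w (by simp [hp]) (by simp [hw]) (by grind) (by grind) (by grind)
  have a5 : G.Adj q w := hadj q w (by simp [hq]) (by simp [hw]) (by grind) (by grind) (by grind)
  have b1 : ¬ G.Adj z w := fun h => hwz h.symm
  have b2 : ¬ G.Adj z v := fun h => hvn z hz.2.2 hz.1 h.symm
  have b3 : ¬ G.Adj p v := fun h => hvn p hp.2.2.2 hp.2.1 h.symm
  have b4 : ¬ G.Adj q v := fun h => hvn q hq.2.2.2 hq.2.1 h.symm
  refine exists_isLabelling_of_fin h5 ![z, p, q, w, v] ?_ ?_ ?_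
  · intro i
    fin_cases i <;> simp [hz, hp, hq, hw, hv]
  · intro i j hij
    fin_cases i <;> fin_cases j <;> simp at hij ⊢ <;> grind
  · intro i j hij
    fin_cases i <;> fin_cases j <;> simp at hij <;>
      simp [graphARel, a1, a2, a3, a4, a5, b1, b2, b3, b4, hvw.symm]

/-- A vertex adjacent to all others leaves two disjoint edges, if all degrees are at least two. -/
theorem bicyclic_five_of_adjCount_eq_four {C : Finset V} (h5 : C.card = 5)
    (hD : G.adjCount C C = 12) (hdeg : ∀ v ∈ C, 2 ≤ G.adjCount {v} C) {u : V} (hu : u ∈ C)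
    (hd : G.adjCount {u} C = 4) :
    22 ≤ (G.connSubsets C).card ∧ ∃ p, G.IsLabelling C (graphLRel 5) p := by
  have hK4 := Finset.card_erase_of_mem hu
  rw [h5] at hK4
  have hDK := adjCount_self_eq_erase (G := G) hu
  have hall : ∀ a ∈ C.erase u, G.Adj u a := fun a ha =>
    adj_of_card_le_adjCount (B := C.erase u)
      (by rw [adjCount_erase_of_not_adj _ (G.loopless.irrefl u)]; omega) ha
  have hge : ∀ a ∈ C.erase u, 1 ≤ G.adjCount {a} (C.erase u) := fun a ha => by
    have h1 := hdeg a (Finset.mem_of_mem_erase ha)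
    have h2 := adjCount_erase_of_adj hu (hall a ha).symm
    omega
  have hone : ∀ a ∈ C.erase u, G.adjCount {a} (C.erase u) = 1 := by
    intro a ha
    by_contra hne
    have := Finset.sum_lt_sum hge ⟨a, ha, lt_of_le_of_ne (hge a ha) (Ne.symm hne)⟩
    rw [← adjCount_eq_sum, Finset.sum_const, hK4] at this
    simp at this
    omega
  have huniq : ∀ a b c, a ∈ C.erase u → b ∈ C.erase u → c ∈ C.erase u → G.Adj a b → G.Adj a c →
      c = b := fun a b c ha hb hc hab hac =>
    eq_of_adjCount_le_one (hone a ha).le hb hab hc hac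
  have hex : ∀ a ∈ C.erase u, ∃ b ∈ C.erase u, G.Adj a b := fun a ha => by
    obtain ⟨a', ha', b, hb, hab⟩ := exists_adj_of_adjCount_pos (hge a ha)
    rw [Finset.mem_singleton.1 ha'] at hab
    exact ⟨b, hb, hab⟩
  obtain ⟨a, ha⟩ : (C.erase u).Nonempty := Finset.card_pos.1 (by omega)
  obtain ⟨b, hb, hab⟩ := hex a ha
  obtain ⟨e, he⟩ : (((C.erase u).erase a).erase b).Nonempty := Finset.card_pos.1 (by
    rw [Finset.card_erase_of_mem (Finset.mem_erase.2 ⟨hab.ne', hb⟩),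
      Finset.card_erase_of_mem ha]; omega)
  rw [Finset.mem_erase, Finset.mem_erase] at he
  obtain ⟨heb, hea, he⟩ := he
  obtain ⟨f, hf, hef⟩ := hex e he
  have hfa : f ≠ a := fun h => heb (huniq a b e ha hb he hab (h ▸ hef.symm))
  have hfb : f ≠ b := fun h => hea (huniq b a e hb ha he hab.symm (h ▸ hef.symm))
  have b1 : ¬ G.Adj a e := fun h => heb (huniq a b e ha hb he hab h)
  have b2 : ¬ G.Adj a f := fun h => hfb (huniq a b f ha hb hf hab h)
  have b3 : ¬ G.Adj b e := fun h => hea (huniq b a e hb ha he hab.symm h)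
  have b4 : ¬ G.Adj b f := fun h => hfa (huniq b a f hb ha hf hab.symm h)
  have a1 := (hall a ha).symm
  have a2 := (hall b hb).symm
  have a3 := hall e he
  have a4 := hall f hf
  have n1 := hab.ne
  have n2 := hef.ne
  have hlow : 22 ≤ (G.connSubsets C).card := by
    have m1 := hall a ha
    have m2 := hall b hb
    have m3 := hall e he
    have m4 := hall f hf
    have c1 : ({u, a, b} : Finset V).card = 3 :=
      Finset.card_eq_three.2 ⟨u, a, b, m1.ne, m2.ne, n1, rfl⟩
    have c2 : ({u, e, f} : Finset V).card = 3 :=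
      Finset.card_eq_three.2 ⟨u, e, f, m3.ne, m4.ne, n2, rfl⟩
    -- sixteen connected sets contain `u`
    have r1 := (isConnSet_triple m1 m2).two_mul_le_connSubsetsAt (v := u) (by simp) (by simp)
      (by simp) n1 m1 m2
    have r2 := (isConnSet_triple m3 m4).two_mul_le_connSubsetsAt (v := u) (by simp) (by simp)
      (by simp) n2 m3 m4
    have r3 := card_mul_card_le (G := G) (A := {u, a, b}) (B := {u, e, f}) (v := u) (by
      ext x
      simp only [Finset.mem_inter, Finset.mem_insert, Finset.mem_singleton]
      grind) rfl
    rw [Finset.mem_erase] at ha hb he hf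
    have r4 := Finset.card_le_card (connSubsetsAt_mono (G := G)
      (A := {u, a, b} ∪ {u, e, f}) (B := C) (by simp [Finset.insert_subset_iff, *]) u)
    rw [c1] at r1
    rw [c2] at r2
    have r5 := Nat.mul_le_mul (show 4 ≤ (G.connSubsetsAt {u, a, b} u).card by omega)
      (show 4 ≤ (G.connSubsetsAt {u, e, f} u).card by omega)
    -- six more are the singletons and the two edges of `C - u`
    have s1 := card_connSubsets_eq (G := G) (A := C) (v := u)
    have s2 := card_connSubsets_eq (G := G) (A := C.erase u) (v := a)
    have s3 := card_connSubsets_eq (G := G) (A := (C.erase u).erase a) (v := b)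
    have t1 := (isConnSet_pair hab).card_le_connSubsetsAt (v := a) (by simp)
    have t2 := Finset.card_le_card (connSubsetsAt_mono (G := G) (A := {a, b}) (B := C.erase u)
      (by simp [Finset.insert_subset_iff, *]) a)
    have t3 := (isConnSet_singleton (G := G) b).card_le_connSubsetsAt (v := b) (by simp)
    have t4 := Finset.card_le_card (connSubsetsAt_mono (G := G) (A := {b})
      (B := (C.erase u).erase a) (by simp [hab.ne', hb]) b)
    have t5 := (isConnSet_pair hef).card_mul_le_two_connSubsets
    have t6 := Finset.card_le_card (connSubsets_mono (G := G) (A := {e, f})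
      (B := ((C.erase u).erase a).erase b) (by simp [Finset.insert_subset_iff, *]))
    rw [Finset.card_pair n1] at t1
    rw [Finset.card_pair n2] at t5
    rw [Finset.card_singleton] at t3
    omega
  rw [Finset.mem_erase] at ha hb he hf
  refine ⟨hlow, exists_isLabelling_of_fin h5 ![a, b, u, e, f] ?_ ?_ ?_⟩
  · intro i
    fin_cases i <;> simp [ha, hb, he, hf, hu]
  · intro i j hij
    fin_cases i <;> fin_cases j <;> simp at hij ⊢ <;> grind
  · intro i j hij
    fin_cases i <;> fin_cases j <;> simp at hij <;>
      simp [graphLRel, a1, a2, a3, a4, b1, b2, b3, b4, hab, hef]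

/-- Without pendant vertices, removing a cut vertex would leave two disjoint edges, hence too few
edges. -/
theorem isConnSet_erase_of_adjCount_eq_three {C : Finset V} (h5 : C.card = 5)
    (hD : G.adjCount C C = 12) (hdeg : ∀ v ∈ C, 2 ≤ G.adjCount {v} C) {u : V} (hu : u ∈ C)
    (hd : G.adjCount {u} C = 3) : G.IsConnSet (C.erase u) := by
  have hK4 := Finset.card_erase_of_mem hu
  rw [h5] at hK4
  have hDK := adjCount_self_eq_erase (G := G) hu
  have hex : ∀ a ∈ C.erase u, ∃ b ∈ C.erase u, G.Adj a b := fun a ha => by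
    obtain ⟨x, hx, y, hy, hxy, hax, hay⟩ := exists_two_of_adjCount
      (hdeg a (Finset.mem_of_mem_erase ha))
    by_cases hxu : x = u
    · exact ⟨y, Finset.mem_erase.2 ⟨fun h => hxy (hxu.trans h.symm), hy⟩, hay⟩
    · exact ⟨x, Finset.mem_erase.2 ⟨hxu, hx⟩, hax⟩
  refine ⟨Finset.card_pos.1 (by omega), fun T hT hne hTK => ?_⟩
  by_contra! hcut
  have hzero : G.adjCount T (C.erase u \ T) = 0 := by
    by_contra h
    obtain ⟨a, ha, b, hb, hab⟩ := exists_adj_of_adjCount_pos (Nat.pos_of_ne_zero h)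
    rw [Finset.mem_sdiff] at hb
    exact hcut a ha b hb.1 hb.2 hab
  have h1 := adjCount_union_self (G := G) (A := T) (B := C.erase u \ T) Finset.disjoint_sdiff
  rw [Finset.union_sdiff_of_subset hT, hzero] at h1
  have h2 := adjCount_self_le (G := G) T
  have h3 := adjCount_self_le (G := G) (C.erase u \ T)
  have h4 := Finset.card_sdiff_add_card_eq_card hT
  have h6 := hne.card_pos
  have h7 := Finset.card_lt_card (hT.ssubset_of_ne hTK)
  obtain h8 | h8 | h8 : T.card = 1 ∨ T.card = 2 ∨ (C.erase u \ T).card = 1 := by omega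
  · obtain ⟨a, rfl⟩ := Finset.card_eq_one.1 h8
    obtain ⟨b, hb, hab⟩ := hex a (hT (Finset.mem_singleton_self a))
    exact hcut a (Finset.mem_singleton_self a) b hb (by simpa using hab.ne') hab
  · have h9 : (C.erase u \ T).card = 2 := by omega
    rw [h8] at h2
    rw [h9] at h3
    omega
  · obtain ⟨a, ha⟩ := Finset.card_eq_one.1 h8
    have haK : a ∈ C.erase u \ T := by simp [ha]
    rw [Finset.mem_sdiff] at haK
    obtain ⟨b, hb, hab⟩ := hex a haK.1
    refine hcut b ?_ a haK.1 haK.2 hab.symm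
    by_contra hbT
    have : b ∈ C.erase u \ T := Finset.mem_sdiff.2 ⟨hb, hbT⟩
    rw [ha, Finset.mem_singleton] at this
    exact hab.ne' this

/-- A vertex `u` of degree three and the vertex `w` not adjacent to it have two common neighbours
`s` and `t`; `{u, t, w}` has a disconnected trace on `{u, s, w}`. -/
theorem thirteen_le_connSubsetsAt {C : Finset V} (h5 : C.card = 5)
    (hdeg : ∀ v ∈ C, 2 ≤ G.adjCount {v} C) {u : V} (hu : u ∈ C)
    (hd : G.adjCount {u} C = 3) : 13 ≤ (G.connSubsetsAt C u).card := by
  have hK4 := Finset.card_erase_of_mem hu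
  rw [h5] at hK4
  have hdK := adjCount_erase_of_not_adj C (G.loopless.irrefl u)
  obtain ⟨w, hw, huw⟩ := exists_not_adj_of_adjCount_lt (G := G) (v := u) (B := C.erase u)
    (by omega)
  have hdw := adjCount_erase_of_not_adj (C.erase u) huw
  have hall : ∀ a ∈ (C.erase u).erase w, G.Adj u a := fun a ha =>
    adj_of_card_le_adjCount (by rw [Finset.card_erase_of_mem hw]; omega) ha
  have hwC := Finset.mem_of_mem_erase hw
  have hwu := (Finset.mem_erase.1 hw).1
  obtain ⟨s, hs, t, ht, hst, hws, hwt⟩ := exists_two_of_adjCount (hdeg w hwC)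
  have hcommon : ∀ a ∈ C, G.Adj w a → G.Adj u a := fun a ha hwa =>
    hall a (Finset.mem_erase.2 ⟨hwa.ne', Finset.mem_erase.2
      ⟨fun h => huw (h ▸ hwa).symm, ha⟩⟩)
  have hus := hcommon s hs hws
  have hut := hcommon t ht hwt
  obtain ⟨z, hz, hzst⟩ : ∃ z ∈ (C.erase u).erase w, z ∉ ({s, t} : Finset V) := by
    refine Finset.exists_mem_notMem_of_card_lt_card ?_
    rw [Finset.card_pair hst, Finset.card_erase_of_mem hw]
    omega
  have huz := hall z hz
  simp only [Finset.mem_insert, Finset.mem_singleton, not_or] at hzst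
  obtain ⟨hzs, hzt⟩ := hzst
  rw [Finset.mem_erase, Finset.mem_erase] at hz
  have n1 := hus.ne
  have n2 := hut.ne
  have n3 := hws.ne
  have n4 := hwt.ne
  have hAB : ({u, s, w} : Finset V) ∩ {u, t, z} = {u} := by
    ext a
    simp only [Finset.mem_inter, Finset.mem_insert, Finset.mem_singleton]
    grind
  have hA3 : ({u, s, w} : Finset V).card = 3 :=
    Finset.card_eq_three.2 ⟨u, s, w, n1, Ne.symm hwu, Ne.symm n3, rfl⟩
  have hB3 : ({u, t, z} : Finset V).card = 3 :=
    Finset.card_eq_three.2 ⟨u, t, z, n2, huz.ne, Ne.symm hzt, rfl⟩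
  have hABC : ({u, s, w} : Finset V) ∪ {u, t, z} = C := by
    refine Finset.eq_of_subset_of_card_le
      (by simp [Finset.insert_subset_iff, *]) ?_
    have := Finset.card_union_add_card_inter ({u, s, w} : Finset V) {u, t, z}
    rw [hAB, Finset.card_singleton] at this
    omega
  have hA : G.IsConnSet {u, s, w} := by
    rw [Finset.insert_comm]
    exact isConnSet_triple hus.symm hws.symm
  have h1 := hA.card_le_connSubsetsAt (v := u) (by simp)
  have h2 := (isConnSet_triple hut huz).two_mul_le_connSubsetsAt (v := u) (by simp)
    (by simp) (by simp) (Ne.symm hzt) hut huz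
  have h3 := card_mul_card_add_le (G := G) hAB hABC {{u, t, w}} (by
    simp only [Finset.mem_singleton]
    rintro S rfl
    refine ⟨by simp [Finset.insert_subset_iff, *], by simp, ?_, fun h => ?_⟩
    · rw [Finset.insert_comm]
      exact isConnSet_triple hut.symm hwt.symm
    · refine not_isConnSet_of_not_adj (v := u) (u := w) (by simp) (by simp) hwu ?_ h.1
      simp only [Finset.mem_inter, Finset.mem_insert, Finset.mem_singleton]
      rintro a ⟨h1, h2⟩ h3
      have := h3.ne
      grind)
  rw [hA3] at h1
  rw [hB3] at h2
  have := Nat.mul_le_mul h1 (show 4 ≤ _ by omega : 4 ≤ (G.connSubsetsAt {u, t, z} u).card)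
  rw [Finset.card_singleton] at h3
  omega

theorem IsConnSet.bicyclic_five {C : Finset V} (hC : G.IsConnSet C) (h5 : C.card = 5)
    (hD : G.adjCount C C = 12) : 22 ≤ (G.connSubsets C).card ∧
      ((G.connSubsets C).card = 22 → (∃ p, G.IsLabelling C (graphLRel 5) p) ∨
        ∃ p, G.IsLabelling C graphARel p) := by
  by_cases hdeg : ∀ v ∈ C, 2 ≤ G.adjCount {v} C
  · obtain ⟨u, hu, hud⟩ : ∃ u ∈ C, 3 ≤ G.adjCount {u} C := by
      by_contra! h
      have := Finset.sum_le_card_nsmul C (fun v => G.adjCount {v} C) 2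
        fun v hv => Nat.le_of_lt_succ (h v hv)
      rw [← adjCount_eq_sum, hD, h5] at this
      simp at this
    have hlt := adjCount_singleton_lt (G := G) hu
    obtain hd | hd : G.adjCount {u} C = 3 ∨ G.adjCount {u} C = 4 := by omega
    · have h1 := thirteen_le_connSubsetsAt h5 hdeg hu hd
      have h2 := (isConnSet_erase_of_adjCount_eq_three h5 hD hdeg hu hd).card_mul_le_two_connSubsets
      rw [Finset.card_erase_of_mem hu, h5] at h2
      rw [card_connSubsets_eq (v := u)]
      exact ⟨by omega, fun h => by omega⟩
    · obtain ⟨h1, h2⟩ := bicyclic_five_of_adjCount_eq_four h5 hD hdeg hu hd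
      exact ⟨h1, fun _ => Or.inl h2⟩
  · push Not at hdeg
    obtain ⟨v, hv, hlt⟩ := hdeg
    rcases hC.two_adj_or_erase hv (by omega) with h | ⟨w, hw, hvw, hu, hK, hDK⟩
    · omega
    · obtain ⟨h1, h2⟩ := bicyclic_five_of_pendant h5 hD hv hw hvw hu hK hDK
      exact ⟨h1, fun h => Or.inr (h2 h)⟩

end SimpleGraph

/-! ### Passage to the number of connected sets of a graph -/

namespace SimpleGraph

section Transfer

variable {V W : Type*} {G : SimpleGraph V} {H : SimpleGraph W}

theorem Iso.numConnectedSets_eq (e : G ≃g H) : G.numConnectedSets = H.numConnectedSets := by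
  unfold numConnectedSets
  rw [← Set.ncard_image_of_injective _ (Set.image_injective.2 e.injective)]
  congr 1
  ext T
  constructor
  · rintro ⟨S, ⟨h1, h2⟩, rfl⟩
    exact ⟨h1.image _, (e.induce (e.injective.injOn.bijOn_image (s := S))).connected_iff.1 h2⟩
  · rintro ⟨h1, h2⟩
    refine ⟨e.symm '' T, ⟨h1.image _, (e.symm.induce
      (e.symm.injective.injOn.bijOn_image (s := T))).connected_iff.1 h2⟩, ?_⟩
    simp [Set.image_image]

theorem IsConnSet.le_two_connSubsets_of_bicyclic [DecidableEq V] {C : Finset V} (hC : G.IsConnSet C)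
    (hD : G.adjCount C C = 2 * C.card + 2) (h5 : 5 ≤ C.card) :
    (C.card + 6) * (C.card - 1) ≤ 2 * (G.connSubsets C).card := by
  induction hk : C.card using Nat.strong_induction_on generalizing C with
  | _ k ih =>
    subst hk
    by_cases h6 : 6 ≤ C.card
    · exact (hC.bicyclic_step hD h6 fun S _ hS hcard hDS =>
        ih S.card (by omega) hS hDS (by omega) rfl).1
    · have hc : C.card = 5 := by omega
      have := (hC.bicyclic_five hc (by omega)).1
      rw [hc]
      omega

variable [Fintype V]

theorem numConnectedSets_eq_card (G : SimpleGraph V) :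
    G.numConnectedSets = (G.connSubsets Finset.univ).card := by
  classical
  rw [numConnectedSets, ← Set.ncard_coe_finset,
    ← Set.ncard_image_of_injective _ (Finset.coe_injective (α := V))]
  congr 1
  ext S
  constructor
  · rintro ⟨-, h⟩
    refine ⟨S.toFinset, ?_, by simp⟩
    rw [Finset.mem_coe, mem_connSubsets, isConnSet_iff_induce_connected, Set.coe_toFinset]
    exact ⟨Finset.subset_univ _, h⟩
  · rintro ⟨T, hT, rfl⟩
    rw [Finset.mem_coe, mem_connSubsets] at hT
    exact ⟨hT.2.1, (isConnSet_iff_induce_connected T).1 hT.2⟩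

theorem adjCount_univ (G : SimpleGraph V) :
    G.adjCount Finset.univ Finset.univ = 2 * G.edgeSet.ncard := by
  classical
  rw [adjCount_eq_sum, ← coe_edgeFinset, Set.ncard_coe_finset, ← sum_degrees_eq_twice_card_edges]
  refine Finset.sum_congr rfl fun v _ => ?_
  rw [adjCount_singleton_left, ← card_neighborFinset_eq_degree, neighborFinset_eq_filter]

theorem IsBicyclic.isConnSet_univ (h : G.IsBicyclic) : G.IsConnSet Finset.univ := by
  classical
  rw [isConnSet_iff_induce_connected, Finset.coe_univ]
  exact (induceUnivIso G).connected_iff.2 h.1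

theorem IsBicyclic.adjCount_univ (h : G.IsBicyclic) :
    G.adjCount Finset.univ Finset.univ = 2 * (Finset.univ : Finset V).card + 2 := by
  rw [SimpleGraph.adjCount_univ, h.2, Finset.card_univ]
  ring

theorem IsLabelling.nonempty_iso {r : ℕ → ℕ → Prop} {p : ℕ → V} {m : ℕ}
    (hp : G.IsLabelling Finset.univ r p) (hm : Fintype.card V = m) (H : SimpleGraph (Fin m))
    (hH : ∀ i j : Fin m, i < j → (H.Adj i j ↔ r i j)) : Nonempty (G ≃g H) := by
  obtain ⟨-, h2, h3⟩ := hp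
  rw [Finset.card_univ, hm] at h2 h3
  have hinj : Function.Injective fun i : Fin m => p i := fun i j hij =>
    Fin.ext (h2 i.2 j.2 hij)
  have hbij := (Fintype.bijective_iff_injective_and_card _).2 ⟨hinj, by simp [hm]⟩
  have hadj : ∀ i j : Fin m, i < j → (G.Adj (p i) (p j) ↔ H.Adj i j) := fun i j hij =>
    (h3 i j hij j.2).trans (hH i j hij).symm
  refine ⟨RelIso.symm ⟨Equiv.ofBijective _ hbij, fun {i j} => ?_⟩⟩
  simp only [Equiv.ofBijective_apply]
  rcases lt_trichotomy i j with h | rfl | h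
  · exact hadj i j h
  · simp
  · rw [G.adj_comm, H.adj_comm]
    exact hadj j i h

end Transfer

/-! ### The extremal graphs -/

section Extremal

theorem connected_of_consecutive {m : ℕ} (hm : 0 < m) (G : SimpleGraph (Fin m))
    (h : ∀ i j : Fin m, (i : ℕ) + 1 = j → G.Adj i j) : G.Connected := by
  obtain ⟨k, rfl⟩ : ∃ k, m = k + 1 := ⟨m - 1, by omega⟩
  refine (pathGraph_connected k).mono fun i j hij => ?_
  rw [pathGraph_adj] at hij
  rcases hij with hij | hij
  · exact h i j hij
  · exact (h j i hij).symm

variable {n : ℕ}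

theorem graphL_adj (hn : 4 < n) {i j : Fin (3 + 3 + (n - 4) - 2)} (hij : i < j) :
    (graphL n).Adj i j ↔ graphLRel n i j := by
  have := i.2
  have := j.2
  rw [Fin.lt_def] at hij
  simp only [graphL, twoCyclesPath, fromRel_adj, graphLRel, ne_eq, Fin.ext_iff]
  omega

theorem graphA_adj {i j : Fin 5} (hij : i < j) : (graphA 5).Adj i j ↔ graphARel i j := by
  rw [Fin.lt_def] at hij
  simp only [graphA, fromRel_adj, graphARel, ne_eq, Fin.ext_iff]
  omega

/-- Edges are counted as pairs of numbers in increasing order. -/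
theorem ncard_edgeSet_eq_card {m : ℕ} (G : SimpleGraph (Fin m)) (F : Finset (ℕ × ℕ))
    (hF : ∀ p, p ∈ F ↔ ∃ i j : Fin m, i < j ∧ G.Adj i j ∧ p = (i.val, j.val)) :
    G.edgeSet.ncard = F.card := by
  rw [← Set.ncard_coe_finset]
  have hinj : Function.Injective fun e : Sym2 (Fin m) => (e.inf.val, e.sup.val) := by
    intro e e' h
    rw [Prod.mk.injEq] at h
    exact Sym2.inf_eq_inf_and_sup_eq_sup.1 ⟨Fin.ext h.1, Fin.ext h.2⟩
  rw [← Set.ncard_image_of_injective _ hinj]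
  congr 1
  ext p
  rw [Finset.mem_coe, hF]
  constructor
  · rintro ⟨e, he, rfl⟩
    induction e with
    | _ a b =>
      rw [mem_edgeSet] at he
      refine ⟨a ⊓ b, a ⊔ b, inf_lt_sup.2 he.ne, ?_, rfl⟩
      rcases le_total a b with h | h
      · rwa [inf_eq_left.2 h, sup_eq_right.2 h]
      · rw [inf_eq_right.2 h, sup_eq_left.2 h]
        exact he.symm
  · rintro ⟨i, j, hij, hadj, rfl⟩
    exact ⟨s(i, j), hadj, by simp [hij.le]⟩

theorem graphL_isBicyclic (hn : 4 < n) : (graphL n).IsBicyclic := by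
  refine ⟨connected_of_consecutive (by omega) _ fun i j hij => ?_, ?_⟩
  · exact (graphL_adj hn (by rw [Fin.lt_def]; omega)).2 (Or.inl hij.symm)
  rw [ncard_edgeSet_eq_card _
    (insert (0, 2) (insert (n - 3, n - 1) ((Finset.range (n - 1)).image fun i => (i, i + 1))))]
  · rw [Finset.card_insert_of_notMem, Finset.card_insert_of_notMem,
      Finset.card_image_of_injective, Finset.card_range, Fintype.card_fin]
    · omega
    · exact fun i j h => (Prod.mk.injEq _ _ _ _ ▸ h).1
    · simp; omega
    · simp; omega
  · rintro ⟨a, b⟩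
    simp only [Finset.mem_insert, Finset.mem_image, Finset.mem_range, Prod.mk.injEq]
    constructor
    · intro h
      have hab : a < b ∧ b < 3 + 3 + (n - 4) - 2 ∧ graphLRel n a b := by
        unfold graphLRel
        rcases h with h | h | ⟨i, hi, h⟩ <;> omega
      exact ⟨⟨a, by omega⟩, ⟨b, hab.2.1⟩, hab.1, (graphL_adj hn hab.1).2 hab.2.2, rfl, rfl⟩
    · rintro ⟨i, j, hij, hadj, rfl, rfl⟩
      have := (graphL_adj hn hij).1 hadj
      have hj := j.2
      unfold graphLRel at this
      rcases this with h | h | h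
      · exact Or.inr (Or.inr ⟨i, by omega, rfl, h.symm⟩)
      · omega
      · omega

theorem graphA_five_isBicyclic : (graphA 5).IsBicyclic := by
  refine ⟨connected_of_consecutive (by omega) _ fun i j hij => ?_, ?_⟩
  · exact (graphA_adj (by rw [Fin.lt_def]; omega)).2 (Or.inl hij.symm)
  rw [ncard_edgeSet_eq_card _ {(0, 1), (1, 2), (2, 3), (3, 4), (0, 2), (1, 3)}]
  · rfl
  · rintro ⟨a, b⟩
    simp only [Finset.mem_insert, Finset.mem_singleton, Prod.mk.injEq]
    constructor
    · intro h
      have hab : a < b ∧ b < 5 ∧ graphARel a b := by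
        unfold graphARel
        omega
      exact ⟨⟨a, by omega⟩, ⟨b, hab.2.1⟩, hab.1, (graphA_adj hab.1).2 hab.2.2, rfl, rfl⟩
    · rintro ⟨i, j, hij, hadj, rfl, rfl⟩
      have := (graphA_adj hij).1 hadj
      have hj := j.2
      unfold graphARel at this
      omega

/-- The connected sets of `graphL n` as sets of numbers: intervals, initial segments without `1`,
final segments without `n - 2`, and everything but `1` and `n - 2`. -/
def graphLConnSets (n : ℕ) : Finset (Finset ℕ) :=
  ((Finset.range n).biUnion fun j => (Finset.range (j + 1)).image fun i => Finset.Icc i j) ∪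
  (((Finset.Ico 2 n).image fun j => (Finset.Icc 0 j).erase 1) ∪
  (((Finset.range (n - 2)).image fun i => (Finset.Icc i (n - 1)).erase (n - 2)) ∪
  {((Finset.range n).erase 1).erase (n - 2)}))

theorem two_mul_card_graphLConnSets_le (hn : 4 < n) :
    2 * (graphLConnSets n).card ≤ (n + 6) * (n - 1) := by
  have h1 : ((Finset.range n).biUnion fun j =>
      (Finset.range (j + 1)).image fun i => Finset.Icc i j).card ≤ ∑ j ∈ Finset.range n, (j + 1) :=
    Finset.card_biUnion_le.trans (Finset.sum_le_sum fun j _ =>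
      Finset.card_image_le.trans (Finset.card_range _).le)
  have h2 : ((Finset.Ico 2 n).image fun j => (Finset.Icc 0 j).erase 1).card ≤ n - 2 :=
    Finset.card_image_le.trans (Nat.card_Ico _ _).le
  have h3 : ((Finset.range (n - 2)).image fun i => (Finset.Icc i (n - 1)).erase (n - 2)).card
      ≤ n - 2 := Finset.card_image_le.trans (Finset.card_range _).le
  have h4 := Finset.card_union_le ((Finset.range n).biUnion fun j =>
      (Finset.range (j + 1)).image fun i => Finset.Icc i j)
    (((Finset.Ico 2 n).image fun j => (Finset.Icc 0 j).erase 1) ∪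
    (((Finset.range (n - 2)).image fun i => (Finset.Icc i (n - 1)).erase (n - 2)) ∪
    {((Finset.range n).erase 1).erase (n - 2)}))
  have h5 := Finset.card_union_le ((Finset.Ico 2 n).image fun j => (Finset.Icc 0 j).erase 1)
    (((Finset.range (n - 2)).image fun i => (Finset.Icc i (n - 1)).erase (n - 2)) ∪
    {((Finset.range n).erase 1).erase (n - 2)})
  have h6 := Finset.card_union_le
    ((Finset.range (n - 2)).image fun i => (Finset.Icc i (n - 1)).erase (n - 2))
    {((Finset.range n).erase 1).erase (n - 2)}
  rw [Finset.card_singleton] at h6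
  have h7 : (∑ j ∈ Finset.range n, (j + 1)) * 2 = n * (n + 1) := by
    have := Finset.sum_range_id_mul_two (n + 1)
    rw [Finset.sum_range_succ'] at this
    simpa [mul_comm] using this
  have h8 : 2 * (graphLConnSets n).card ≤ n * (n + 1) + 2 * (2 * (n - 2) + 1) := by
    unfold graphLConnSets
    omega
  obtain ⟨m, rfl⟩ : ∃ m, n = m + 5 := ⟨n - 5, by omega⟩
  refine h8.trans (le_of_eq ?_)
  rw [show m + 5 - 2 = m + 3 by omega, show m + 5 - 1 = m + 4 by omega]
  ring

theorem map_mem_graphLConnSets (hn : 4 < n) {S : Finset (Fin (3 + 3 + (n - 4) - 2))}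
    (hS : (graphL n).IsConnSet S) : S.map Fin.valEmbedding ∈ graphLConnSets n := by
  obtain ⟨i, hi, hmin⟩ := S.exists_min_image id hS.1
  obtain ⟨j, hj, hmax⟩ := S.exists_max_image id hS.1
  simp only [id] at hmin hmax
  set T := S.map Fin.valEmbedding with hT
  have hmem : ∀ k, k ∈ T ↔ ∃ a ∈ S, a.val = k := by
    intro k
    simp [hT]
  have hiT : i.val ∈ T := (hmem _).2 ⟨i, hi, rfl⟩
  have hjT : j.val ∈ T := (hmem _).2 ⟨j, hj, rfl⟩
  have hle : ∀ k ∈ T, i.val ≤ k ∧ k ≤ j.val := by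
    intro k hk
    obtain ⟨a, ha, rfl⟩ := (hmem k).1 hk
    exact ⟨hmin a ha, hmax a ha⟩
  -- an edge must jump over every missing number, and only two edges jump
  have hgap : ∀ k, i.val < k → k < j.val → k ∉ T →
      (k = 1 ∧ 0 ∈ T ∧ 2 ∈ T) ∨ (k = n - 2 ∧ n - 3 ∈ T ∧ n - 1 ∈ T) := by
    intro k hik hkj hk
    obtain ⟨a, ha, b, hb, hbT, hab⟩ := hS.2 (S.filter fun a => a.val < k)
      (Finset.filter_subset _ _) ⟨i, Finset.mem_filter.2 ⟨hi, hik⟩⟩ (fun h => by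
        rw [← h] at hj
        have := (Finset.mem_filter.1 hj).2
        omega)
    rw [Finset.mem_filter] at ha hbT
    have haT := (hmem _).2 ⟨a, ha.1, rfl⟩
    have hbT' := (hmem _).2 ⟨b, hb, rfl⟩
    have hbk : k < b.val := by
      have h1 : ¬ b.val < k := fun h => hbT ⟨hb, h⟩
      have h2 : b.val ≠ k := fun h => hk (h ▸ hbT')
      omega
    have hr := (graphL_adj hn (show a < b from ha.2.trans hbk)).1 hab
    unfold graphLRel at hr
    rcases hr with h | ⟨h1, h2⟩ | ⟨h1, h2⟩
    · omega
    · rw [h1] at haT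
      rw [h2] at hbT'
      exact Or.inl ⟨by omega, haT, hbT'⟩
    · rw [show a.val = n - 3 by omega] at haT
      rw [show b.val = n - 1 by omega] at hbT'
      exact Or.inr ⟨by omega, haT, hbT'⟩
  have hjn := j.2
  have hij := (hle _ hiT).2
  unfold graphLConnSets
  simp only [Finset.mem_union, Finset.mem_biUnion, Finset.mem_image, Finset.mem_range,
    Finset.mem_Ico, Finset.mem_singleton]
  by_cases h1 : i.val < 1 ∧ 1 < j.val ∧ 1 ∉ T
  · by_cases h2 : i.val < n - 2 ∧ n - 2 < j.val ∧ n - 2 ∉ T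
    · refine Or.inr (Or.inr (Or.inr ?_))
      ext k
      rw [Finset.mem_erase, Finset.mem_erase, Finset.mem_range]
      grind
    · refine Or.inr (Or.inl ⟨j.val, by omega, ?_⟩)
      ext k
      rw [Finset.mem_erase, Finset.mem_Icc]
      grind
  · by_cases h2 : i.val < n - 2 ∧ n - 2 < j.val ∧ n - 2 ∉ T
    · refine Or.inr (Or.inr (Or.inl ⟨i.val, h2.1, ?_⟩))
      ext k
      rw [Finset.mem_erase, Finset.mem_Icc]
      grind
    · refine Or.inl ⟨j.val, by omega, i.val, by omega, ?_⟩
      ext k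
      rw [Finset.mem_Icc]
      grind

theorem two_mul_numConnectedSets_graphL (hn : 4 < n) :
    2 * (graphL n).numConnectedSets = (n + 6) * (n - 1) := by
  have hc : (Finset.univ : Finset (Fin (3 + 3 + (n - 4) - 2))).card = n := by
    rw [Finset.card_univ, Fintype.card_fin]; omega
  rw [numConnectedSets_eq_card]
  refine le_antisymm (le_trans (Nat.mul_le_mul_left 2 ?_) (two_mul_card_graphLConnSets_le hn)) ?_
  · rw [← Finset.card_image_of_injective _ (Finset.map_injective Fin.valEmbedding)]
    refine Finset.card_le_card fun T hT => ?_
    obtain ⟨S, hS, rfl⟩ := Finset.mem_image.1 hT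
    exact map_mem_graphLConnSets hn (mem_connSubsets.1 hS).2
  · have h := graphL_isBicyclic hn
    have := h.isConnSet_univ.le_two_connSubsets_of_bicyclic h.adjCount_univ (by omega)
    rwa [hc] at this

instance decidableRelGraphAFiveAdj : DecidableRel (graphA 5).Adj := by
  unfold graphA; infer_instance

/-- The right-hand side of the definition of `IsConnSet`, in a form that can be evaluated. -/
theorem card_cut_graphA_five : (Finset.univ.filter fun S : Finset (Fin 5) => S.Nonempty ∧
    ∀ T ∈ S.powerset, T.Nonempty → T ≠ S →
      ∃ a ∈ T, ∃ b ∈ S, b ∉ T ∧ (graphA 5).Adj a b).card = 22 := by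
  decide +kernel

theorem numConnectedSets_graphA_five_le : (graphA 5).numConnectedSets ≤ 22 := by
  rw [numConnectedSets_eq_card]
  refine (Finset.card_le_card (t := Finset.univ.filter fun S => S.Nonempty ∧
    ∀ T ∈ S.powerset, T.Nonempty → T ≠ S → ∃ a ∈ T, ∃ b ∈ S, b ∉ T ∧ (graphA 5).Adj a b)
    fun S hS => ?_).trans card_cut_graphA_five.le
  obtain ⟨h1, h2⟩ := (mem_connSubsets.1 hS).2
  exact Finset.mem_filter.2 ⟨Finset.mem_univ S, h1, fun T hT => h2 T (Finset.mem_powerset.1 hT)⟩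

end Extremal

end SimpleGraph
/-! ### The minimum -/

theorem mainTheorem1 (n : ℕ) (hn : 4 < n) :
    (Fintype.card (Fin (3 + 3 + (n - 4) - 2)) = n ∧ (SimpleGraph.graphL n).IsBicyclic) ∧
    (SimpleGraph.graphA 5).IsBicyclic ∧
    ((SimpleGraph.graphL n).numConnectedSets : ℚ) = ((n : ℚ) + 6) * ((n : ℚ) - 1) / 2 ∧
    ∀ (V : Type*) [Fintype V] (G : SimpleGraph V), Fintype.card V = n → G.IsBicyclic →
      (SimpleGraph.graphL n).numConnectedSets ≤ G.numConnectedSets ∧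
      (5 < n → (G.numConnectedSets = (SimpleGraph.graphL n).numConnectedSets ↔
        Nonempty (G ≃g SimpleGraph.graphL n))) ∧
      (n = 5 → (G.numConnectedSets = (SimpleGraph.graphL 5).numConnectedSets ↔
        Nonempty (G ≃g SimpleGraph.graphL 5) ∨ Nonempty (G ≃g SimpleGraph.graphA 5))) := by
  have hcard : 3 + 3 + (n - 4) - 2 = n := by omega
  have hL := SimpleGraph.two_mul_numConnectedSets_graphL hn
  refine ⟨⟨by rw [Fintype.card_fin, hcard], SimpleGraph.graphL_isBicyclic hn⟩,
    SimpleGraph.graphA_five_isBicyclic, ?_, ?_⟩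
  · have : (2 : ℚ) * (SimpleGraph.graphL n).numConnectedSets = (n + 6) * (n - 1) := by
      have h := congrArg (Nat.cast : ℕ → ℚ) hL
      push_cast [Nat.cast_sub (show 1 ≤ n by omega)] at h
      exact h
    linarith
  · intro V _ G hV hG
    classical
    have hc : (Finset.univ : Finset V).card = n := by rw [Finset.card_univ, hV]
    have hconn := hG.isConnSet_univ
    have hD := hG.adjCount_univ
    have hbound := hconn.le_two_connSubsets_of_bicyclic hD (by omega)
    rw [hc] at hbound
    rw [SimpleGraph.numConnectedSets_eq_card G]
    refine ⟨by omega, fun h6 => ⟨fun heq => ?_, fun ⟨e⟩ => ?_⟩, ?_⟩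
    · obtain ⟨p, hp⟩ := (hconn.bicyclic_step hD (by omega) fun S _ hS hcard hDS =>
        hS.le_two_connSubsets_of_bicyclic hDS (by omega)).2 (by rw [heq, hL, hc])
      rw [hc] at hp
      exact hp.nonempty_iso (by omega) _ fun i j hij => SimpleGraph.graphL_adj hn hij
    · rw [← SimpleGraph.numConnectedSets_eq_card, e.numConnectedSets_eq]
    · rintro rfl
      refine ⟨fun heq => ?_, fun h => ?_⟩
      · rcases (hconn.bicyclic_five hc (by omega)).2 (by omega) with ⟨p, hp⟩ | ⟨p, hp⟩
        · exact Or.inl (hp.nonempty_iso hV _ fun i j hij => SimpleGraph.graphL_adj hn hij)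
        · exact Or.inr (hp.nonempty_iso hV _ fun i j hij => SimpleGraph.graphA_adj hij)
      · rcases h with h | h
        · obtain ⟨e⟩ := h
          rw [← SimpleGraph.numConnectedSets_eq_card, e.numConnectedSets_eq]
        · obtain ⟨e⟩ := h
          have h1 := SimpleGraph.numConnectedSets_graphA_five_le
          rw [← e.numConnectedSets_eq, SimpleGraph.numConnectedSets_eq_card G] at h1
          omega
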